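/- Let $n\ge 1$, $k\ge 1$, let $I_1,\dots,I_n$ be independent $\{0,1\}$-valued random variables with $\Pr[I_i=1]=p_i$, and let $S_n=\sum_{i=1}^{n-k+1}\prod_{j=i}^{i+k-1}I_j$ be the number of $k$-runs in the sequence. Put $\mu_n=\mathbb{E}S_n$, $B_n=\sqrt{\operatorname{Var}(S_n)}$. Then $\mu_n=\sum_{i=1}^{n-k+1}\prod_{j=i}^{i+k-1}p_j$. Suppose $B_n>0$ (which forces $k\le n$), let $W=(S_n-\mu_n)/B_n$, and let $d_{\mathrm K}(\mathscr{L}(W),\mathcal{N}(0,1))=\sup_{x\in\mathbb{R}}|\Pr[W\le x]-\Pr[Z\le x]|$ with $Z$ standard normal. Then $$d_{\mathrm K}(\mathscr{L}(W),\mathcal{N}(0,1))\le\frac{(14\sqrt2+8)\,k^{3/2}\mu_n^{1/2}}{B_n^2}+\frac{102\,k^2\mu_n}{B_n^3}.$$ In particular, if $p_i=p\in(0,1)$ for all $i$ and $k$ is fixed, then $B_n>0$ for all $n\ge k$ and $d_{\mathrm K}(\mathscr{L}(W),\mathcal{N}(0,1))=O(n^{-1/2})$ as $n\to\infty$; that is,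 there is a constant $C$ depending only on $k$ and $p$ such that $d_{\mathrm K}(\mathscr{L}(W),\mathcal{N}(0,1))\le C\,n^{-1/2}$ for all $n\ge k$. -/

import Mathlib

open MeasureTheory ProbabilityTheory

/-- Kolmogorov distance of two (finite) measures on the real line: the supremum distance of their
distribution functions. -/
noncomputable def kolmogorovDist (μ ν : Measure ℝ) : ℝ :=
  ⨆ x : ℝ, |μ.real (Set.Iic x) - ν.real (Set.Iic x)|

/-- `I 1, …, I n` are independent indicator random variables on `(Ω, P)` with
`P[I i = 1] = p i`. (The values of `I` and `p` outside `{1, …, n}` are irrelevant.) -/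
structure IsIndepIndicators {Ω : Type*} [MeasurableSpace Ω] (P : Measure Ω) (n : ℕ)
    (I : ℕ → Ω → ℝ) (p : ℕ → ℝ) : Prop where
  measurable : ∀ i ∈ Finset.Icc 1 n, Measurable (I i)
  zero_or_one : ∀ i ∈ Finset.Icc 1 n, ∀ ω, I i ω = 0 ∨ I i ω = 1
  prob_one : ∀ i ∈ Finset.Icc 1 n, P.real {ω | I i ω = 1} = p i
  indep : iIndepFun (fun i : Finset.Icc 1 n => I i) P

/-- The sum over all windows `{i, …, i + k - 1} ⊆ {1, …, n}` of length `k` (that is, over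
`1 ≤ i ≤ n - k + 1`) of the product of `x` over the window. -/
def windowSum (k n : ℕ) (x : ℕ → ℝ) : ℝ :=
  ∑ i ∈ Finset.Icc 1 (n + 1 - k), ∏ j ∈ Finset.Ico i (i + k), x j

/-- The number `S_n` of `k`-runs in `I 1, …, I n`. -/
def runCount {Ω : Type*} (k n : ℕ) (I : ℕ → Ω → ℝ) (ω : Ω) : ℝ :=
  windowSum k n (fun j => I j ω)

/-- The mean `μ_n` of the number of `k`-runs. -/
noncomputable def runMean {Ω : Type*} [MeasurableSpace Ω] (P : Measure Ω) (k n : ℕ)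
    (I : ℕ → Ω → ℝ) : ℝ :=
  ∫ ω, runCount k n I ω ∂P

/-- The standard deviation `B_n` of the number of `k`-runs. -/
noncomputable def runSD {Ω : Type*} [MeasurableSpace Ω] (P : Measure Ω) (k n : ℕ)
    (I : ℕ → Ω → ℝ) : ℝ :=
  √(variance (runCount k n I) P)

/-- The standardized number of `k`-runs, `W = (S_n - μ_n) / B_n`. -/
noncomputable def runStandardized {Ω : Type*} [MeasurableSpace Ω] (P : Measure Ω) (k n : ℕ)
    (I : ℕ → Ω → ℝ) (ω : Ω) : ℝ :=
  (runCount k n I ω - runMean P k n I) / runSD P k n I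

/-!
The normal approximation is proved by Stein's method for locally dependent sums. Write
`W = ∑ ξ i` with `ξ i` the centred indicator of a run on the window starting at `i`, divided by the
standard deviation `B`, and let `η i` be the sum of the `ξ j` whose windows meet that of `i`. Then
`ξ i` is independent of `W - η i`, so for the solution `f` of the Stein equation
`f' w = w f w + 1{w ≤ z} - Φ z` one has `E[W f W] = ∑ E[ξ i (f W - f (W - η i))]`. Expanding `f` to
first order, which is legitimate up to a quadratic error unless `W` is within `δ = 2 k / B` of the
threshold `z`, gives (`abs_measureReal_le_sub_stdNormalCDF_le`)

`|P (W ≤ z) - Φ z| ≤ E|1 - ∑ ξ i η i| + δ E[Y (|W| + c)] + 2 E[Y 1{z - δ < W ≤ z + δ}]`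

with `Y = ∑ |ξ i η i|`.

The last term is estimated without a concentration inequality for `W`, by averaging over thresholds (`kolmogorovDist_le_of_local_bound`): for about `8 E Y` adjacent
thresholds with spacing `2 δ` the events in question add up to a single interval event, whose
probability is at most its normal probability plus twice the Kolmogorov distance (the factor `Y` is
replaced by its mean at the cost of its standard deviation). Divided by the number of thresholds,
the distance reappears with a factor at most `1 / 2` and is absorbed; moving the threshold costs
only `O (E Y * δ)`, by the Lipschitz property of `Φ`.

What remains are `E Y ≤ 2 k μ / B ^ 2` and the variances of `∑ ξ i η i` and of `Y`, which are at
most `24 k ^ 3 μ / B ^ 4` because terms with indices at distance at least `3 k` are independent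
(`variance_sum_le_of_indepFun_far`). Together this is `kolmogorovDist_le_of_window_dependence`.

For constant `p` window products are nonnegatively correlated, so the variance of the number of runs
is at least the number of windows times `p ^ k (1 - p ^ k)` (`le_runSD_sq`), and the rate follows.
-/

/-! ### The normal distribution function and Mills' ratio -/

/-- The standard normal distribution function. -/
noncomputable def stdNormalCDF (z : ℝ) : ℝ := (gaussianReal 0 1).real (Set.Iic z)

lemma gaussianPDFReal_std_pos (x : ℝ) : 0 < gaussianPDFReal 0 1 x :=
  gaussianPDFReal_pos 0 1 x one_ne_zero

lemma hasDerivAt_gaussianPDFReal_std (x : ℝ) :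
    HasDerivAt (gaussianPDFReal 0 1) (-x * gaussianPDFReal 0 1 x) x := by
  have h1 : HasDerivAt (fun y : ℝ => -(y - 0) ^ 2 / (2 * ((1 : NNReal) : ℝ))) (-x) x := by
    have := (((hasDerivAt_id x).sub_const 0).pow 2).neg.div_const (2 * ((1 : NNReal) : ℝ))
    convert! this using 1
    simp
    ring
  have h2 := (h1.exp).const_mul (√(2 * Real.pi * ((1 : NNReal) : ℝ)))⁻¹
  rw [gaussianPDFReal_def]
  convert! h2 using 1
  ring

lemma continuous_gaussianPDFReal_std : Continuous (gaussianPDFReal 0 1) :=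
  continuous_iff_continuousAt.2 fun x => (hasDerivAt_gaussianPDFReal_std x).continuousAt

lemma stdNormalCDF_eq_integral (z : ℝ) :
    stdNormalCDF z = ∫ x in Set.Iic z, gaussianPDFReal 0 1 x := by
  rw [stdNormalCDF, Measure.real, gaussianReal_apply_eq_integral _ one_ne_zero,
    ENNReal.toReal_ofReal]
  exact integral_nonneg fun x => gaussianPDFReal_nonneg 0 1 x

lemma stdNormalCDF_sub (a b : ℝ) :
    stdNormalCDF b - stdNormalCDF a = ∫ x in a..b, gaussianPDFReal 0 1 x := by
  rw [stdNormalCDF_eq_integral, stdNormalCDF_eq_integral]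
  exact intervalIntegral.integral_Iic_sub_Iic (integrable_gaussianPDFReal 0 1).integrableOn
    (integrable_gaussianPDFReal 0 1).integrableOn

lemma hasDerivAt_stdNormalCDF (z : ℝ) :
    HasDerivAt stdNormalCDF (gaussianPDFReal 0 1 z) z := by
  have h := intervalIntegral.integral_hasDerivAt_right
    (continuous_gaussianPDFReal_std.intervalIntegrable 0 z)
    (continuous_gaussianPDFReal_std.stronglyMeasurableAtFilter _ _)
    continuous_gaussianPDFReal_std.continuousAt
  refine (h.add_const (stdNormalCDF 0)).congr_of_eventuallyEq (Filter.Eventually.of_forall ?_)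
  intro x
  linarith [stdNormalCDF_sub 0 x]

lemma stdNormalCDF_nonneg (z : ℝ) : 0 ≤ stdNormalCDF z := measureReal_nonneg

lemma stdNormalCDF_le_one (z : ℝ) : stdNormalCDF z ≤ 1 := measureReal_le_one

lemma monotone_stdNormalCDF : Monotone stdNormalCDF := fun _ _ h =>
  measureReal_mono (Set.Iic_subset_Iic.2 h)

lemma stdNormalCDF_neg (z : ℝ) : stdNormalCDF (-z) = 1 - stdNormalCDF z := by
  have h := integral_comp_neg_Iic (-z) (gaussianPDFReal 0 1)
  have h2 : ∀ x, gaussianPDFReal 0 1 (-x) = gaussianPDFReal 0 1 x := by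
    intro x; simp [gaussianPDFReal_def]
  simp only [h2, neg_neg] at h
  rw [stdNormalCDF_eq_integral, stdNormalCDF_eq_integral, h,
    ← integral_gaussianPDFReal_eq_one 0 (v := 1) one_ne_zero,
    ← intervalIntegral.integral_Iic_add_Ioi (b := z) (integrable_gaussianPDFReal 0 1).integrableOn
    (integrable_gaussianPDFReal 0 1).integrableOn]
  ring

lemma two_mul_stdNormalCDF_zero : 2 * stdNormalCDF 0 = 1 := by
  have := stdNormalCDF_neg 0
  rw [neg_zero] at this
  linarith

lemma gaussianPDFReal_std_zero : gaussianPDFReal 0 1 0 = (√(2 * Real.pi))⁻¹ := by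
  simp [gaussianPDFReal_def]

/-- The maximum is `1 / √(2 π) = 0.3989…`. -/
lemma gaussianPDFReal_std_le (x : ℝ) : gaussianPDFReal 0 1 x ≤ 2 / 5 := by
  have h1 : gaussianPDFReal 0 1 x ≤ (√(2 * Real.pi))⁻¹ := by
    simp only [gaussianPDFReal_def, NNReal.coe_one, mul_one, sub_zero]
    refine mul_le_of_le_one_right (by positivity) (Real.exp_le_one_iff.2 ?_)
    have := sq_nonneg x
    linarith
  have h2 : (5 / 2 : ℝ) ≤ √(2 * Real.pi) := by
    apply Real.le_sqrt_of_sq_le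
    linarith [Real.pi_gt_d2]
  refine h1.trans ?_
  rw [inv_le_comm₀ (by positivity) (by norm_num)]
  linarith

lemma stdNormalCDF_sub_le {a b : ℝ} (hab : a ≤ b) :
    stdNormalCDF b - stdNormalCDF a ≤ 2 / 5 * (b - a) :=
  image_sub_le_mul_sub_of_deriv_le
    (fun x => (hasDerivAt_stdNormalCDF x).differentiableAt)
    (fun x => by rw [(hasDerivAt_stdNormalCDF x).deriv]; exact gaussianPDFReal_std_le x) hab

/-- The reflected Mills ratio of the standard normal law: the quotient of the distribution function
and the density. -/
noncomputable def millsRatio (w : ℝ) : ℝ := stdNormalCDF w / gaussianPDFReal 0 1 w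

lemma millsRatio_nonneg (w : ℝ) : 0 ≤ millsRatio w :=
  div_nonneg (stdNormalCDF_nonneg w) (gaussianPDFReal_std_pos w).le

lemma hasDerivAt_millsRatio (w : ℝ) : HasDerivAt millsRatio (1 + w * millsRatio w) w := by
  have h := (hasDerivAt_stdNormalCDF w).div (hasDerivAt_gaussianPDFReal_std w)
    (gaussianPDFReal_std_pos w).ne'
  convert! h using 1
  have := (gaussianPDFReal_std_pos w).ne'
  rw [millsRatio]
  field_simp
  ring

/-- The classical normal tail bound, from integrating `-w φ(x) ≤ -x φ(x) = φ'(x)` over `x ≤ w`. -/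
lemma neg_mul_stdNormalCDF_le (w : ℝ) : -w * stdNormalCDF w ≤ gaussianPDFReal 0 1 w := by
  have hint : Integrable fun x => -x * gaussianPDFReal 0 1 x := by
    have h := ((integrable_mul_exp_neg_mul_sq (b := 1 / 2) (by norm_num)).const_mul
      (-(√(2 * Real.pi))⁻¹))
    refine h.congr (Filter.Eventually.of_forall fun x => ?_)
    simp only [gaussianPDFReal_def, NNReal.coe_one, mul_one, sub_zero]
    rw [show -(1 / 2) * x ^ 2 = -x ^ 2 / 2 by ring]
    ring
  have hlim : Filter.Tendsto (gaussianPDFReal 0 1) Filter.atBot (nhds 0) :=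
    tendsto_zero_of_hasDerivAt_of_integrableOn_Iic (a := 0)
      (fun x _ => hasDerivAt_gaussianPDFReal_std x) hint.integrableOn
      (integrable_gaussianPDFReal 0 1).integrableOn
  have h := integral_Iic_of_hasDerivAt_of_tendsto' (a := w)
    (fun x _ => hasDerivAt_gaussianPDFReal_std x) hint.integrableOn hlim
  rw [sub_zero] at h
  rw [← h, stdNormalCDF_eq_integral, ← integral_const_mul]
  refine setIntegral_mono_on ((integrable_gaussianPDFReal 0 1).integrableOn.const_mul _)
    hint.integrableOn measurableSet_Iic fun x hx => ?_
  have hx : x ≤ w := hx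
  exact mul_le_mul_of_nonneg_right (by linarith) (gaussianPDFReal_nonneg 0 1 x)

lemma one_add_mul_millsRatio_nonneg (w : ℝ) : 0 ≤ 1 + w * millsRatio w := by
  have h := neg_mul_stdNormalCDF_le w
  rw [← div_le_one (gaussianPDFReal_std_pos w), mul_div_assoc] at h
  rw [millsRatio]
  linarith

lemma monotone_millsRatio : Monotone millsRatio :=
  monotone_of_deriv_nonneg (fun x => (hasDerivAt_millsRatio x).differentiableAt) fun x => by
    rw [(hasDerivAt_millsRatio x).deriv]
    exact one_add_mul_millsRatio_nonneg x

/-- The exact value is `√(2 π) / 2 = 1.2533…`. -/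
lemma millsRatio_zero_le : millsRatio 0 ≤ 63 / 50 := by
  rw [millsRatio, gaussianPDFReal_std_zero, div_inv_eq_mul]
  have h : √(2 * Real.pi) ≤ 63 / 25 := by
    rw [Real.sqrt_le_left (by norm_num)]
    linarith [Real.pi_lt_d2]
  have := two_mul_stdNormalCDF_zero
  rw [show stdNormalCDF 0 = 1 / 2 by linarith]
  linarith

/-- Both sides equal `Φ(w) (1 - Φ(w)) / φ(w)`. -/
lemma one_sub_stdNormalCDF_mul_millsRatio (w : ℝ) :
    (1 - stdNormalCDF w) * millsRatio w = stdNormalCDF w * millsRatio (-w) := by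
  have h2 : gaussianPDFReal 0 1 (-w) = gaussianPDFReal 0 1 w := by
    simp [gaussianPDFReal_def]
  rw [millsRatio, millsRatio, stdNormalCDF_neg, h2]
  ring

/-- The value of the Stein solution at its threshold, where it is largest: it increases
before the threshold and decreases after it. -/
lemma one_sub_stdNormalCDF_mul_millsRatio_le (w : ℝ) :
    (1 - stdNormalCDF w) * millsRatio w ≤ 63 / 50 := by
  have key : ∀ w ≤ 0, (1 - stdNormalCDF w) * millsRatio w ≤ 63 / 50 := by
    intro w hw
    have h1 := (monotone_millsRatio hw).trans millsRatio_zero_le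
    have h2 := stdNormalCDF_nonneg w
    have h3 := millsRatio_nonneg w
    nlinarith
  rcases le_total w 0 with hw | hw
  · exact key w hw
  · have := key (-w) (by linarith)
    rw [stdNormalCDF_neg] at this
    rw [one_sub_stdNormalCDF_mul_millsRatio]
    linarith

lemma one_sub_stdNormalCDF_mul_deriv_millsRatio_le (w : ℝ) :
    (1 - stdNormalCDF w) * (1 + w * millsRatio w) ≤ 1 := by
  have h0 := stdNormalCDF_nonneg w
  have h2 := one_sub_stdNormalCDF_mul_millsRatio w
  have h3 := mul_nonneg h0 (one_add_mul_millsRatio_nonneg (-w))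
  calc (1 - stdNormalCDF w) * (1 + w * millsRatio w)
      = 1 - stdNormalCDF w + w * ((1 - stdNormalCDF w) * millsRatio w) := by ring
    _ = 1 - stdNormalCDF w * (1 + -w * millsRatio (-w)) := by rw [h2]; ring
    _ ≤ 1 := by linarith

/-! ### The Stein equation for half-lines -/

/-- The bounded solution `f` of the Stein equation `f' w = w f w + 1{w ≤ z} - Φ z`. -/
noncomputable def steinSolution (z w : ℝ) : ℝ :=
  if w ≤ z then (1 - stdNormalCDF z) * millsRatio w else stdNormalCDF z * millsRatio (-w)

/-- The derivative of the Stein solution, as prescribed by the Stein equation; at the threshold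
`w = z` it is the left derivative. -/
noncomputable def steinDeriv (z w : ℝ) : ℝ :=
  w * steinSolution z w + (Set.Iic z).indicator 1 w - stdNormalCDF z

lemma steinSolution_of_le {z w : ℝ} (h : w ≤ z) :
    steinSolution z w = (1 - stdNormalCDF z) * millsRatio w := if_pos h

lemma steinSolution_of_ge {z w : ℝ} (h : z ≤ w) :
    steinSolution z w = stdNormalCDF z * millsRatio (-w) := by
  rcases h.eq_or_lt with rfl | h
  · rw [steinSolution_of_le le_rfl, one_sub_stdNormalCDF_mul_millsRatio]
  · exact if_neg (not_le.2 h)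

lemma steinDeriv_of_le {z w : ℝ} (h : w ≤ z) :
    steinDeriv z w = (1 - stdNormalCDF z) * (1 + w * millsRatio w) := by
  rw [steinDeriv, steinSolution_of_le h, Set.indicator_of_mem (Set.mem_Iic.2 h), Pi.one_apply]
  ring

lemma steinDeriv_of_gt {z w : ℝ} (h : z < w) :
    steinDeriv z w = -(stdNormalCDF z * (1 + -w * millsRatio (-w))) := by
  rw [steinDeriv, steinSolution_of_ge h.le, Set.indicator_of_notMem (by simpa using h)]
  ring

lemma steinSolution_nonneg (z w : ℝ) : 0 ≤ steinSolution z w := by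
  have h0 := stdNormalCDF_nonneg z
  have h1 := stdNormalCDF_le_one z
  rcases le_total w z with h | h
  · rw [steinSolution_of_le h]
    exact mul_nonneg (by linarith) (millsRatio_nonneg w)
  · rw [steinSolution_of_ge h]
    exact mul_nonneg h0 (millsRatio_nonneg _)

lemma steinSolution_le (z w : ℝ) : steinSolution z w ≤ 63 / 50 := by
  rcases le_total w z with h | h
  · rw [steinSolution_of_le h]
    refine le_trans ?_ (one_sub_stdNormalCDF_mul_millsRatio_le w)
    exact mul_le_mul_of_nonneg_right (by linarith [monotone_stdNormalCDF h]) (millsRatio_nonneg w)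
  · rw [steinSolution_of_ge h]
    refine le_trans ?_ (one_sub_stdNormalCDF_mul_millsRatio_le (-w))
    exact mul_le_mul_of_nonneg_right
      (by linarith [monotone_stdNormalCDF h, stdNormalCDF_neg w]) (millsRatio_nonneg _)

lemma abs_steinSolution_le (z w : ℝ) : |steinSolution z w| ≤ 63 / 50 := by
  rw [abs_of_nonneg (steinSolution_nonneg z w)]
  exact steinSolution_le z w

lemma abs_steinDeriv_le_one (z w : ℝ) : |steinDeriv z w| ≤ 1 := by
  rcases le_or_gt w z with h | h
  · have h1 := one_add_mul_millsRatio_nonneg w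
    have h2 := monotone_stdNormalCDF h
    have h3 := stdNormalCDF_le_one z
    rw [steinDeriv_of_le h, abs_of_nonneg (mul_nonneg (by linarith) h1)]
    refine le_trans ?_ (one_sub_stdNormalCDF_mul_deriv_millsRatio_le w)
    exact mul_le_mul_of_nonneg_right (by linarith) h1
  · have h1 := one_add_mul_millsRatio_nonneg (-w)
    have h2 := monotone_stdNormalCDF h.le
    rw [steinDeriv_of_gt h, abs_neg, abs_of_nonneg (mul_nonneg (stdNormalCDF_nonneg z) h1)]
    refine le_trans ?_ (one_sub_stdNormalCDF_mul_deriv_millsRatio_le (-w))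
    exact mul_le_mul_of_nonneg_right (by linarith [stdNormalCDF_neg w]) h1

lemma hasDerivWithinAt_steinSolution_left {z w : ℝ} (h : w ≤ z) :
    HasDerivWithinAt (steinSolution z) (steinDeriv z w) (Set.Iic z) w := by
  have h1 := ((hasDerivAt_millsRatio w).const_mul (1 - stdNormalCDF z)).hasDerivWithinAt
    (s := Set.Iic z)
  rw [steinDeriv_of_le h]
  exact h1.congr (fun x hx => steinSolution_of_le hx) (steinSolution_of_le h)

lemma hasDerivWithinAt_steinSolution_right {z w : ℝ} (h : z < w) :
    HasDerivWithinAt (steinSolution z) (steinDeriv z w) (Set.Ioi z) w := by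
  have h0 : HasDerivAt (fun x => millsRatio (-x)) (-(1 + -w * millsRatio (-w))) w := by
    have := (hasDerivAt_millsRatio (-w)).comp w (hasDerivAt_neg w)
    convert! this using 1
    ring
  have h1 := (h0.const_mul (stdNormalCDF z)).hasDerivWithinAt (s := Set.Ioi z)
  rw [steinDeriv_of_gt h, ← mul_neg]
  exact h1.congr (fun x hx => steinSolution_of_ge (le_of_lt hx)) (steinSolution_of_ge h.le)

lemma continuous_steinSolution (z : ℝ) : Continuous (steinSolution z) := by
  have hR : Continuous millsRatio :=
    continuous_iff_continuousAt.2 fun x => (hasDerivAt_millsRatio x).continuousAt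
  refine Continuous.if_le (by fun_prop) (by fun_prop) continuous_id continuous_const ?_
  rintro w rfl
  exact one_sub_stdNormalCDF_mul_millsRatio w

lemma measurable_steinDeriv (z : ℝ) : Measurable (steinDeriv z) := by
  refine ((measurable_id.mul (continuous_steinSolution z).measurable).add
    (measurable_one.indicator measurableSet_Iic)).sub measurable_const

lemma abs_steinSolution_sub_le (z a b : ℝ) :
    |steinSolution z b - steinSolution z a| ≤ |b - a| := by
  have hL : ∀ a ≤ z, ∀ b ≤ z, |steinSolution z b - steinSolution z a| ≤ |b - a| := by
    intro a ha b hb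
    simpa using (convex_Iic z).norm_image_sub_le_of_norm_hasDerivWithin_le (C := 1)
      (fun x hx => hasDerivWithinAt_steinSolution_left hx)
      (fun x _ => abs_steinDeriv_le_one z x) ha hb
  have hR : ∀ a, z < a → ∀ b, z < b → |steinSolution z b - steinSolution z a| ≤ |b - a| := by
    intro a ha b hb
    simpa using (convex_Ioi z).norm_image_sub_le_of_norm_hasDerivWithin_le (C := 1)
      (fun x hx => hasDerivWithinAt_steinSolution_right hx)
      (fun x _ => abs_steinDeriv_le_one z x) ha hb
  have hR' : ∀ b, z < b → |steinSolution z b - steinSolution z z| ≤ b - z := by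
    intro b hb
    have h1 : Filter.Tendsto (fun x => |steinSolution z b - steinSolution z x|)
        (nhdsWithin z (Set.Ioi z)) (nhds |steinSolution z b - steinSolution z z|) :=
      ((continuous_const.sub (continuous_steinSolution z)).abs.tendsto z).mono_left
        nhdsWithin_le_nhds
    have h2 : Filter.Tendsto (fun x => |b - x|) (nhdsWithin z (Set.Ioi z)) (nhds |b - z|) :=
      ((continuous_const.sub continuous_id).abs.tendsto z).mono_left nhdsWithin_le_nhds
    have h3 := le_of_tendsto_of_tendsto h1 h2
      (eventually_nhdsWithin_of_forall fun x hx => hR x hx b hb)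
    rwa [abs_of_pos (sub_pos.2 hb)] at h3
  have hLR : ∀ a ≤ z, ∀ b, z < b → |steinSolution z b - steinSolution z a| ≤ |b - a| := by
    intro a ha b hb
    have h1 := hR' b hb
    have h2 := hL a ha z le_rfl
    rw [abs_of_nonneg (sub_nonneg.2 ha)] at h2
    rw [abs_of_nonneg (show 0 ≤ b - a by linarith)]
    have := abs_sub_le (steinSolution z b) (steinSolution z z) (steinSolution z a)
    linarith
  rcases le_or_gt a z with ha | ha <;> rcases le_or_gt b z with hb | hb
  · exact hL a ha b hb
  · exact hLR a ha b hb
  · rw [abs_sub_comm, abs_sub_comm b]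
    exact hLR b hb a ha
  · exact hR a ha b hb

/-- On either side of the threshold only the term `w f w` of `steinDeriv` varies. -/
lemma abs_steinDeriv_sub_le {z a b : ℝ} (h : a ≤ z ∧ b ≤ z ∨ z < a ∧ z < b) :
    |steinDeriv z a - steinDeriv z b| ≤ |a - b| * (|b| + 63 / 50) := by
  have h1 : steinDeriv z a - steinDeriv z b =
      (a - b) * steinSolution z a + b * (steinSolution z a - steinSolution z b) := by
    have : (Set.Iic z).indicator (1 : ℝ → ℝ) a = (Set.Iic z).indicator 1 b := by
      rcases h with ⟨ha, hb⟩ | ⟨ha, hb⟩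
      · simp [ha, hb]
      · simp [not_le.2 ha, not_le.2 hb]
    rw [steinDeriv, steinDeriv, this]
    ring
  rw [h1]
  refine (abs_add_le _ _).trans ?_
  rw [abs_mul, abs_mul]
  have h2 := mul_le_mul_of_nonneg_left (abs_steinSolution_le z a) (abs_nonneg (a - b))
  have h3 := mul_le_mul_of_nonneg_left (abs_steinSolution_sub_le z b a) (abs_nonneg b)
  linarith

/-- First-order expansion of the Stein solution. The remainder is quadratic unless the threshold may
lie between `w - h` and `w`. -/
lemma abs_steinSolution_sub_sub_le {z w h δ : ℝ} (hδ : |h| ≤ δ) :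
    |steinSolution z w - steinSolution z (w - h) - h * steinDeriv z w| ≤
      |h| * (δ * (|w| + 63 / 50) + 2 * (Set.Ioc (z - δ) (z + δ)).indicator 1 w) := by
  have hδ0 : 0 ≤ δ := (abs_nonneg h).trans hδ
  have hh := abs_le.1 hδ
  by_cases hw : w ∈ Set.Ioc (z - δ) (z + δ)
  · rw [Set.indicator_of_mem hw, Pi.one_apply]
    refine (abs_sub _ _).trans ?_
    have h1 := abs_steinSolution_sub_le z (w - h) w
    rw [sub_sub_cancel] at h1
    have h2 := mul_le_mul_of_nonneg_left (abs_steinDeriv_le_one z w) (abs_nonneg h)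
    rw [abs_mul]
    have h3 : 0 ≤ |h| * (δ * (|w| + 63 / 50)) := by positivity
    linarith
  rw [Set.indicator_of_notMem hw, mul_zero, add_zero]
  have mvt : ∀ s : Set ℝ, Convex ℝ s → w ∈ s → w - h ∈ s →
      (∀ x ∈ s, HasDerivWithinAt (steinSolution z) (steinDeriv z x) s x) →
      (∀ x ∈ s, x ≤ z ∧ w ≤ z ∨ z < x ∧ z < w) →
      |steinSolution z w - steinSolution z (w - h) - h * steinDeriv z w| ≤
        |h| * (δ * (|w| + 63 / 50)) := by
    intro s hs hw hwh hd hside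
    have hseg : segment ℝ (w - h) w ⊆ s := hs.segment_subset hwh hw
    have := (convex_segment (w - h) w).norm_image_sub_le_of_norm_hasDerivWithin_le
      (f := fun x => steinSolution z x - x * steinDeriv z w)
      (f' := fun x => steinDeriv z x - 1 * steinDeriv z w) (C := δ * (|w| + 63 / 50))
      (fun x hx => ((hd x (hseg hx)).mono hseg).sub
        ((hasDerivWithinAt_id x _).mul_const _)) ?_
      (left_mem_segment ℝ _ _) (right_mem_segment ℝ _ _)
    · simp only [Real.norm_eq_abs, sub_sub_cancel] at this
      rw [mul_comm |h|]
      refine (le_of_eq ?_).trans this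
      congr 1
      ring
    · intro x hx
      rw [one_mul, Real.norm_eq_abs]
      refine (abs_steinDeriv_sub_le (hside x (hseg hx))).trans ?_
      refine mul_le_mul_of_nonneg_right ?_ (by positivity)
      rw [segment_eq_uIcc, Set.mem_uIcc] at hx
      rw [abs_le]
      constructor <;> rcases hx with hx | hx <;> linarith
  rcases le_or_gt w (z - δ) with hwz | hwz
  · exact mvt (Set.Iic z) (convex_Iic z) (by simp only [Set.mem_Iic]; linarith)
      (by simp only [Set.mem_Iic]; linarith) (fun x hx => hasDerivWithinAt_steinSolution_left hx)
      fun x hx => Or.inl ⟨hx, by linarith⟩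
  · have hwz' : z + δ < w := not_le.1 fun h => hw ⟨hwz, h⟩
    exact mvt (Set.Ioi z) (convex_Ioi z) (by simp only [Set.mem_Ioi]; linarith)
      (by simp only [Set.mem_Ioi]; linarith) (fun x hx => hasDerivWithinAt_steinSolution_right hx)
      fun x hx => Or.inr ⟨hx, by linarith⟩

/-! ### Bounded measurable functions -/

section BoundedMeasurable

variable {Ω : Type*} [MeasurableSpace Ω]

/-- A bounded measurable real function. -/
structure IsBddMeasurable (f : Ω → ℝ) : Prop where
  measurable : Measurable f
  exists_abs_le : ∃ C, ∀ ω, |f ω| ≤ C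

namespace IsBddMeasurable

variable {f g : Ω → ℝ}

lemma const (c : ℝ) : IsBddMeasurable fun _ : Ω => c := ⟨measurable_const, |c|, fun _ => le_rfl⟩

lemma add (hf : IsBddMeasurable f) (hg : IsBddMeasurable g) :
    IsBddMeasurable fun ω => f ω + g ω := by
  obtain ⟨C, hC⟩ := hf.exists_abs_le
  obtain ⟨D, hD⟩ := hg.exists_abs_le
  exact ⟨hf.measurable.add hg.measurable, C + D,
    fun ω => (abs_add_le _ _).trans (add_le_add (hC ω) (hD ω))⟩

lemma mul (hf : IsBddMeasurable f) (hg : IsBddMeasurable g) :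
    IsBddMeasurable fun ω => f ω * g ω := by
  obtain ⟨C, hC⟩ := hf.exists_abs_le
  obtain ⟨D, hD⟩ := hg.exists_abs_le
  refine ⟨hf.measurable.mul hg.measurable, C * D, fun ω => ?_⟩
  rw [abs_mul]
  exact mul_le_mul (hC ω) (hD ω) (abs_nonneg _) ((abs_nonneg _).trans (hC ω))

lemma sub (hf : IsBddMeasurable f) (hg : IsBddMeasurable g) :
    IsBddMeasurable fun ω => f ω - g ω := by
  simpa [sub_eq_add_neg] using hf.add ((const (-1)).mul hg)

lemma div_const (hf : IsBddMeasurable f) (c : ℝ) : IsBddMeasurable fun ω => f ω / c := by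
  simpa [div_eq_mul_inv] using hf.mul (const c⁻¹)

lemma abs (hf : IsBddMeasurable f) : IsBddMeasurable fun ω => |f ω| := by
  obtain ⟨C, hC⟩ := hf.exists_abs_le
  exact ⟨hf.measurable.abs, C, fun ω => by rw [abs_abs]; exact hC ω⟩

lemma pow (hf : IsBddMeasurable f) (n : ℕ) : IsBddMeasurable fun ω => f ω ^ n := by
  induction n with
  | zero => simpa using const 1
  | succ n ih => simpa only [pow_succ] using ih.mul hf

lemma sum {ι : Type*} {s : Finset ι} {f : ι → Ω → ℝ} (hf : ∀ i ∈ s, IsBddMeasurable (f i)) :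
    IsBddMeasurable fun ω => ∑ i ∈ s, f i ω := by
  classical
  induction s using Finset.induction_on with
  | empty => simpa using const 0
  | insert a s ha ih =>
    simp only [Finset.sum_insert ha]
    exact (hf a (by simp)).add (ih fun i hi => hf i (by simp [hi]))

lemma comp_measurable {F : ℝ → ℝ} {C : ℝ} (hF : Measurable F) (hC : ∀ x, |F x| ≤ C)
    (hf : Measurable f) : IsBddMeasurable fun ω => F (f ω) :=
  ⟨hF.comp hf, C, fun ω => hC (f ω)⟩

lemma memLp (hf : IsBddMeasurable f) (P : Measure Ω) [IsFiniteMeasure P] (q : ENNReal) :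
    MemLp f q P := by
  obtain ⟨C, hC⟩ := hf.exists_abs_le
  exact MemLp.of_bound hf.measurable.aestronglyMeasurable C (Filter.Eventually.of_forall hC)

lemma integrable (hf : IsBddMeasurable f) (P : Measure Ω) [IsFiniteMeasure P] :
    Integrable f P := memLp_one_iff_integrable.1 (hf.memLp P 1)

end IsBddMeasurable

end BoundedMeasurable

/-! ### Stein's method for the Kolmogorov distance -/

lemma abs_indicator_one_le (s : Set ℝ) (x : ℝ) : |s.indicator (1 : ℝ → ℝ) x| ≤ 1 := by
  by_cases h : x ∈ s <;> simp [h]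

lemma kolmogorovDist_map_stdNormal_eq {Ω : Type*} [MeasurableSpace Ω]
    {P : Measure Ω} {W : Ω → ℝ} (hW : Measurable W) :
    kolmogorovDist (P.map W) (gaussianReal 0 1) =
      ⨆ x : ℝ, |P.real {ω | W ω ≤ x} - stdNormalCDF x| := by
  unfold kolmogorovDist
  congr 1
  ext x
  rw [map_measureReal_apply hW measurableSet_Iic]
  rfl

section Stein

variable {Ω : Type*} [MeasurableSpace Ω] {P : Measure Ω} [IsProbabilityMeasure P]

/-- Stein's method for a sum `W = ∑ ξ i` of centred bounded variables in which `ξ i` is independent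
of `W - η i` for a small `η i`: the error at the threshold `z` is controlled by the fluctuations of
`∑ ξ i * η i` and by the mass that `∑ |ξ i * η i|` puts on the event that `W` is close to `z`. -/
theorem abs_measureReal_le_sub_stdNormalCDF_le {ι : Type*} {s : Finset ι} {ξ η : ι → Ω → ℝ}
    {W : Ω → ℝ} {δ : ℝ} (hW : ∀ ω, W ω = ∑ i ∈ s, ξ i ω)
    (hξ : ∀ i ∈ s, IsBddMeasurable (ξ i)) (hη : ∀ i ∈ s, IsBddMeasurable (η i))
    (hδ : ∀ i ∈ s, ∀ ω, |η i ω| ≤ δ) (h0 : ∀ i ∈ s, ∫ ω, ξ i ω ∂P = 0)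
    (hind : ∀ i ∈ s, IndepFun (ξ i) (fun ω => W ω - η i ω) P) (z : ℝ) :
    |P.real {ω | W ω ≤ z} - stdNormalCDF z| ≤
      ∫ ω, |1 - ∑ i ∈ s, ξ i ω * η i ω| ∂P +
      δ * ∫ ω, (∑ i ∈ s, |ξ i ω * η i ω|) * (|W ω| + 63 / 50) ∂P +
      2 * ∫ ω, (∑ i ∈ s, |ξ i ω * η i ω|) *
        (Set.Ioc (z - δ) (z + δ)).indicator 1 (W ω) ∂P := by
  have hWb : IsBddMeasurable W := by
    rw [show W = fun ω => ∑ i ∈ s, ξ i ω from funext hW]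
    exact .sum hξ
  have hf := (continuous_steinSolution z).measurable
  have hfW : IsBddMeasurable fun ω => steinSolution z (W ω) :=
    .comp_measurable hf (abs_steinSolution_le z) hWb.measurable
  have hfWη : ∀ i ∈ s, IsBddMeasurable fun ω => steinSolution z (W ω - η i ω) := fun i hi =>
    .comp_measurable hf (abs_steinSolution_le z) (hWb.sub (hη i hi)).measurable
  have hgW : IsBddMeasurable fun ω => steinDeriv z (W ω) :=
    .comp_measurable (measurable_steinDeriv z) (abs_steinDeriv_le_one z) hWb.measurable
  have hQ : IsBddMeasurable fun ω => ∑ i ∈ s, ξ i ω * η i ω :=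
    .sum fun i hi => (hξ i hi).mul (hη i hi)
  have hY : IsBddMeasurable fun ω => ∑ i ∈ s, |ξ i ω * η i ω| :=
    .sum fun i hi => ((hξ i hi).mul (hη i hi)).abs
  have hind1 : IsBddMeasurable fun ω => (Set.Iic z).indicator (1 : ℝ → ℝ) (W ω) :=
    .comp_measurable (measurable_one.indicator measurableSet_Iic) (abs_indicator_one_le _)
      hWb.measurable
  have hind2 : IsBddMeasurable fun ω =>
      (Set.Ioc (z - δ) (z + δ)).indicator (1 : ℝ → ℝ) (W ω) :=
    .comp_measurable (measurable_one.indicator measurableSet_Ioc) (abs_indicator_one_le _)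
      hWb.measurable
  set A : Ω → ℝ := fun ω =>
    ∑ i ∈ s, ξ i ω * (steinSolution z (W ω) - steinSolution z (W ω - η i ω)) with hA
  have hAb : IsBddMeasurable A := .sum fun i hi => (hξ i hi).mul (hfW.sub (hfWη i hi))
  -- Independence and centring allow to subtract `f (W - η i)`.
  have hA1 : ∫ ω, W ω * steinSolution z (W ω) ∂P = ∫ ω, A ω ∂P := by
    have h1 : ∀ i ∈ s, ∫ ω, ξ i ω * steinSolution z (W ω - η i ω) ∂P = 0 := by
      intro i hi
      have h2 : IndepFun (ξ i) (fun ω => steinSolution z (W ω - η i ω)) P :=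
        (hind i hi).comp measurable_id hf
      rw [h2.integral_fun_mul_eq_mul_integral (hξ i hi).measurable.aestronglyMeasurable
        (hfWη i hi).measurable.aestronglyMeasurable, h0 i hi, zero_mul]
    simp only [hA, mul_sub, hW, Finset.sum_mul, Finset.sum_sub_distrib]
    simp only [← hW]
    rw [integral_sub, integral_finsetSum (f := fun i ω => ξ i ω * steinSolution z (W ω - η i ω)),
      Finset.sum_eq_zero h1, sub_zero]
    · exact fun i hi => ((hξ i hi).mul (hfWη i hi)).integrable P
    · exact (IsBddMeasurable.sum fun i hi => (hξ i hi).mul hfW).integrable P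
    · exact (IsBddMeasurable.sum fun i hi => (hξ i hi).mul (hfWη i hi)).integrable P
  have hmain : P.real {ω | W ω ≤ z} - stdNormalCDF z =
      ∫ ω, (steinDeriv z (W ω) - A ω) ∂P := by
    have h1 : ∫ ω, (Set.Iic z).indicator (1 : ℝ → ℝ) (W ω) ∂P = P.real {ω | W ω ≤ z} := by
      have h2 : MeasurableSet {ω | W ω ≤ z} := hWb.measurable measurableSet_Iic
      rw [← integral_indicator_one h2]
      rfl
    rw [integral_sub (hgW.integrable P) (hAb.integrable P), ← hA1]
    simp only [steinDeriv]
    rw [integral_sub (((hWb.mul hfW).add hind1).integrable P) (integrable_const _),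
      integral_add ((hWb.mul hfW).integrable P) (hind1.integrable P), h1]
    simp only [integral_const, probReal_univ, one_smul]
    ring
  have hpt : ∀ ω, |steinDeriv z (W ω) - A ω| ≤ |1 - ∑ i ∈ s, ξ i ω * η i ω| +
      δ * ((∑ i ∈ s, |ξ i ω * η i ω|) * (|W ω| + 63 / 50)) +
      2 * ((∑ i ∈ s, |ξ i ω * η i ω|) *
        (Set.Ioc (z - δ) (z + δ)).indicator (1 : ℝ → ℝ) (W ω)) := by
    intro ω
    have h1 : steinDeriv z (W ω) - A ω =
        (1 - ∑ i ∈ s, ξ i ω * η i ω) * steinDeriv z (W ω) -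
        ∑ i ∈ s, ξ i ω * (steinSolution z (W ω) - steinSolution z (W ω - η i ω) -
          η i ω * steinDeriv z (W ω)) := by
      simp only [hA, mul_sub, sub_mul, Finset.sum_sub_distrib, Finset.sum_mul, mul_assoc]
      ring
    have h2 : |∑ i ∈ s, ξ i ω * (steinSolution z (W ω) - steinSolution z (W ω - η i ω) -
          η i ω * steinDeriv z (W ω))| ≤ ∑ i ∈ s, |ξ i ω * η i ω| *
          (δ * (|W ω| + 63 / 50) + 2 * (Set.Ioc (z - δ) (z + δ)).indicator 1 (W ω)) := by
      refine (Finset.abs_sum_le_sum_abs _ _).trans (Finset.sum_le_sum fun i hi => ?_)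
      rw [abs_mul, abs_mul, mul_assoc]
      exact mul_le_mul_of_nonneg_left (abs_steinSolution_sub_sub_le (hδ i hi ω)) (abs_nonneg _)
    have h3 : |(1 - ∑ i ∈ s, ξ i ω * η i ω) * steinDeriv z (W ω)| ≤
        |1 - ∑ i ∈ s, ξ i ω * η i ω| := by
      rw [abs_mul]
      exact mul_le_of_le_one_right (abs_nonneg _) (abs_steinDeriv_le_one z _)
    rw [← Finset.sum_mul] at h2
    rw [h1]
    refine (abs_sub _ _).trans ((add_le_add h3 h2).trans (le_of_eq ?_))
    ring
  have hI1 := ((IsBddMeasurable.const 1).sub hQ).abs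
  have hI2 := (IsBddMeasurable.const δ).mul (hY.mul (hWb.abs.add (.const (63 / 50))))
  have hI3 := (IsBddMeasurable.const 2).mul (hY.mul hind2)
  rw [hmain]
  refine abs_integral_le_integral_abs.trans ?_
  refine (integral_mono ((hgW.sub hAb).abs.integrable P) (((hI1.add hI2).add hI3).integrable P)
    hpt).trans (le_of_eq ?_)
  rw [integral_add ((hI1.add hI2).integrable P) (hI3.integrable P),
    integral_add (hI1.integrable P) (hI2.integrable P), integral_const_mul, integral_const_mul]

lemma abs_measureReal_le_sub_stdNormalCDF_le_one (W : Ω → ℝ) (x : ℝ) :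
    |P.real {ω | W ω ≤ x} - stdNormalCDF x| ≤ 1 := by
  have h1 : P.real {ω | W ω ≤ x} ≤ 1 := measureReal_le_one
  have h2 : 0 ≤ P.real {ω | W ω ≤ x} := measureReal_nonneg
  have h3 := stdNormalCDF_le_one x
  have h4 := stdNormalCDF_nonneg x
  rw [abs_le]
  constructor <;> linarith

lemma kolmogorovDist_map_stdNormal_le_one {W : Ω → ℝ} (hW : Measurable W) :
    kolmogorovDist (P.map W) (gaussianReal 0 1) ≤ 1 := by
  rw [kolmogorovDist_map_stdNormal_eq hW]
  exact ciSup_le fun x => abs_measureReal_le_sub_stdNormalCDF_le_one W x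

lemma abs_sub_le_kolmogorovDist_map_stdNormal {W : Ω → ℝ} (hW : Measurable W) (x : ℝ) :
    |P.real {ω | W ω ≤ x} - stdNormalCDF x| ≤ kolmogorovDist (P.map W) (gaussianReal 0 1) := by
  rw [kolmogorovDist_map_stdNormal_eq hW]
  exact le_ciSup (f := fun x => |P.real {ω | W ω ≤ x} - stdNormalCDF x|)
    ⟨1, by rintro _ ⟨y, rfl⟩; exact abs_measureReal_le_sub_stdNormalCDF_le_one W y⟩ x

/-- Consecutive half-open intervals of equal length partition their union. -/
lemma sum_indicator_Ioc_eq {δ : ℝ} (hδ : 0 ≤ δ) (a w : ℝ) (N : ℕ) :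
    ∑ j ∈ Finset.range N, (Set.Ioc (a + (2 * j + 1) * δ - δ) (a + (2 * j + 1) * δ + δ)).indicator
      (1 : ℝ → ℝ) w = (Set.Ioc a (a + 2 * N * δ)).indicator 1 w := by
  induction N with
  | zero => simp
  | succ N ih =>
    rw [Finset.sum_range_succ, ih]
    have h0 : 0 ≤ (N : ℝ) * δ := by positivity
    have e1 : a + (2 * N + 1) * δ - δ = a + 2 * N * δ := by ring
    have e2 : a + (2 * N + 1) * δ + δ = a + 2 * (N + 1 : ℕ) * δ := by push_cast; ring
    have e3 : a + 2 * ((N + 1 : ℕ) : ℝ) * δ = a + 2 * N * δ + 2 * δ := by push_cast; ring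
    have hu : Set.Ioc a (a + 2 * (N + 1 : ℕ) * δ) =
        Set.Ioc a (a + 2 * N * δ) ∪ Set.Ioc (a + 2 * N * δ) (a + 2 * (N + 1 : ℕ) * δ) :=
      (Set.Ioc_union_Ioc_eq_Ioc (by linarith) (by linarith)).symm
    rw [e1, e2, hu, Set.indicator_union_of_disjoint]
    rw [Set.disjoint_left]
    intro x hx hx'
    exact absurd hx.2 (not_le.2 hx'.1)

/-- Averaging over thresholds: if the error at every threshold `z` is at most `T` plus twice the
mass of `Y` on the event that `W` is within `δ` of `z`, then the average of these bounds over about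
`8 m` adjacent thresholds involves that event for one long interval only. The probability of that
event is compared with its normal value, and the comparison error is absorbed on the left. -/
theorem kolmogorovDist_le_of_local_bound {W Y : Ω → ℝ} {δ T m σ : ℝ}
    (hW : Measurable W) (hY : IsBddMeasurable Y) (hm1 : 1 ≤ m) (hσ : ∫ ω, |Y ω - m| ∂P ≤ σ)
    (hδ : 0 ≤ δ)
    (hloc : ∀ z, |P.real {ω | W ω ≤ z} - stdNormalCDF z| ≤
      T + 2 * ∫ ω, Y ω * (Set.Ioc (z - δ) (z + δ)).indicator 1 (W ω) ∂P) :
    kolmogorovDist (P.map W) (gaussianReal 0 1) ≤ 16 * m * δ + 2 * T + σ / 2 := by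
  set D := kolmogorovDist (P.map W) (gaussianReal 0 1) with hD
  have hDle : ∀ x, |P.real {ω | W ω ≤ x} - stdNormalCDF x| ≤ D :=
    abs_sub_le_kolmogorovDist_map_stdNormal hW
  have hD0 : 0 ≤ D := (abs_nonneg _).trans (hDle 0)
  have hσ0 : 0 ≤ σ := (integral_nonneg fun ω => abs_nonneg _).trans hσ
  have hindb : ∀ a b : ℝ, IsBddMeasurable fun ω => (Set.Ioc a b).indicator (1 : ℝ → ℝ) (W ω) :=
    fun a b => .comp_measurable (measurable_one.indicator measurableSet_Ioc)
      (abs_indicator_one_le _) hW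
  set N : ℕ := ⌈8 * m⌉₊ with hN
  have hN1 : 8 * m ≤ N := Nat.le_ceil _
  have hN2 : (N : ℝ) < 8 * m + 1 := Nat.ceil_lt_add_one (by linarith)
  have hN0 : (0 : ℝ) < N := by linarith
  have hJ : ∀ a b : ℝ, a ≤ b →
      ∫ ω, Y ω * (Set.Ioc a b).indicator 1 (W ω) ∂P ≤ m * (2 / 5 * (b - a) + 2 * D) + σ := by
    intro a b hab
    have h1 : ∫ ω, (Set.Ioc a b).indicator (1 : ℝ → ℝ) (W ω) ∂P =
        P.real {ω | W ω ≤ b} - P.real {ω | W ω ≤ a} := by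
      have h2 : ∀ ω, (Set.Ioc a b).indicator (1 : ℝ → ℝ) (W ω) =
          (W ⁻¹' Set.Ioc a b).indicator 1 ω := fun ω => rfl
      simp_rw [h2]
      rw [integral_indicator_one (hW measurableSet_Ioc),
        ← measureReal_sdiff (Set.ofPred_subset_ofPred.2 fun ω h => le_trans h hab)
          (hW measurableSet_Iic)]
      congr 1
      ext ω
      simp [and_comm]
    have h2 := abs_le.1 (hDle a)
    have h3 := abs_le.1 (hDle b)
    have h4 := stdNormalCDF_sub_le hab
    have h5 : ∀ ω, Y ω * (Set.Ioc a b).indicator 1 (W ω) ≤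
        m * (Set.Ioc a b).indicator 1 (W ω) + |Y ω - m| := by
      intro ω
      have := le_abs_self (Y ω - m)
      by_cases h : W ω ∈ Set.Ioc a b
      · simp only [Set.indicator_of_mem h, Pi.one_apply]
        linarith
      · simp [Set.indicator_of_notMem h]
    have hI1 := (IsBddMeasurable.const m).mul (hindb a b)
    have hI2 := (hY.sub (.const m)).abs
    have h6 := integral_mono ((hY.mul (hindb a b)).integrable P) ((hI1.add hI2).integrable P) h5
    rw [integral_add (hI1.integrable P) (hI2.integrable P), integral_const_mul, h1] at h6
    have h7 : m * (P.real {ω | W ω ≤ b} - P.real {ω | W ω ≤ a}) ≤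
        m * (2 / 5 * (b - a) + 2 * D) := mul_le_mul_of_nonneg_left (by linarith) (by linarith)
    linarith
  have havg : ∀ a : ℝ, ∑ j ∈ Finset.range N,
      |P.real {ω | W ω ≤ a + (2 * j + 1) * δ} - stdNormalCDF (a + (2 * j + 1) * δ)| ≤
      N * T + 2 * (m * (2 / 5 * (2 * N * δ) + 2 * D) + σ) := by
    intro a
    refine (Finset.sum_le_sum (g := fun j : ℕ => T + 2 * ∫ ω, Y ω *
      (Set.Ioc (a + (2 * j + 1) * δ - δ) (a + (2 * j + 1) * δ + δ)).indicator 1 (W ω) ∂P)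
      fun j _ => hloc _).trans ?_
    rw [Finset.sum_add_distrib, ← Finset.mul_sum, ← integral_finsetSum]
    · simp_rw [← Finset.mul_sum, sum_indicator_Ioc_eq hδ]
      have := hJ a (a + 2 * N * δ) (by
        have : 0 ≤ 2 * (N : ℝ) * δ := by positivity
        linarith)
      rw [add_sub_cancel_left] at this
      simp only [Finset.sum_const, Finset.card_range, nsmul_eq_mul]
      linarith
    · exact fun j _ => (hY.mul (hindb _ _)).integrable P
  have hfin : ∀ x : ℝ, N * x ≤ N * T + 2 * (m * (2 / 5 * (2 * N * δ) + 2 * D) + σ) +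
      N * (2 / 5 * (2 * (N - 1) * δ)) → x ≤ 8 * m * δ + T + D / 2 + σ / 4 := by
    intro x hx
    have h1 : 4 * m * D ≤ N * (D / 2) := by nlinarith
    have h2 : 2 * σ ≤ N * (σ / 4) := by nlinarith
    have h3 : (N : ℝ) * (2 / 5 * (2 * (N - 1) * δ)) ≤ N * (2 / 5 * (2 * (8 * m) * δ)) := by
      gcongr
      linarith
    refine le_of_mul_le_mul_left ?_ hN0
    nlinarith
  have hlast : ∀ j ∈ Finset.range N, (0 : ℝ) ≤ j ∧ (j : ℝ) ≤ N - 1 := by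
    intro j hj
    refine ⟨Nat.cast_nonneg j, ?_⟩
    have : j + 1 ≤ N := Finset.mem_range.1 hj
    have : ((j + 1 : ℕ) : ℝ) ≤ N := Nat.cast_le.2 this
    push_cast at this
    linarith
  have hpt : ∀ x, |P.real {ω | W ω ≤ x} - stdNormalCDF x| ≤ 8 * m * δ + T + D / 2 + σ / 4 := by
    intro x
    rw [abs_le']
    constructor <;> apply hfin
    -- Thresholds to the right of `x` bound the distribution function of `W` from above.
    · have h1 : ∑ j ∈ Finset.range N, (P.real {ω | W ω ≤ x} - stdNormalCDF x) ≤
          ∑ j ∈ Finset.range N, (|P.real {ω | W ω ≤ x - δ + (2 * j + 1) * δ} -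
            stdNormalCDF (x - δ + (2 * j + 1) * δ)| + 2 / 5 * (2 * (N - 1) * δ)) := by
        refine Finset.sum_le_sum fun j hj => ?_
        obtain ⟨hj0, hj1⟩ := hlast j hj
        have hx : x - δ + (2 * j + 1) * δ = x + 2 * j * δ := by ring
        rw [hx]
        have hx0 : 0 ≤ 2 * (j : ℝ) * δ := by positivity
        have h2 : P.real {ω | W ω ≤ x} ≤ P.real {ω | W ω ≤ x + 2 * j * δ} :=
          measureReal_mono (Set.ofPred_subset_ofPred.2 fun ω h => by linarith)
        have h3 := stdNormalCDF_sub_le (show x ≤ x + 2 * j * δ by linarith)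
        have h4 := le_abs_self (P.real {ω | W ω ≤ x + 2 * j * δ} - stdNormalCDF (x + 2 * j * δ))
        have h5 : (j : ℝ) * δ ≤ (N - 1) * δ := mul_le_mul_of_nonneg_right hj1 hδ
        linarith
      rw [Finset.sum_add_distrib] at h1
      simp only [Finset.sum_const, Finset.card_range, nsmul_eq_mul] at h1
      have := havg (x - δ)
      linarith
    -- Thresholds to the left of `x` bound it from below.
    · have h1 : ∑ j ∈ Finset.range N, -(P.real {ω | W ω ≤ x} - stdNormalCDF x) ≤
          ∑ j ∈ Finset.range N, (|P.real {ω | W ω ≤ x - (2 * N - 1) * δ + (2 * j + 1) * δ} -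
            stdNormalCDF (x - (2 * N - 1) * δ + (2 * j + 1) * δ)| +
            2 / 5 * (2 * (N - 1) * δ)) := by
        refine Finset.sum_le_sum fun j hj => ?_
        obtain ⟨hj0, hj1⟩ := hlast j hj
        have hx : x - (2 * N - 1) * δ + (2 * j + 1) * δ = x - 2 * (N - 1 - j) * δ := by ring
        rw [hx]
        have hx0 : 0 ≤ 2 * ((N : ℝ) - 1 - j) * δ :=
          mul_nonneg (mul_nonneg zero_le_two (by linarith)) hδ
        have h2 : P.real {ω | W ω ≤ x - 2 * (N - 1 - j) * δ} ≤ P.real {ω | W ω ≤ x} :=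
          measureReal_mono (Set.ofPred_subset_ofPred.2 fun ω h => by linarith)
        have h3 := stdNormalCDF_sub_le (show x - 2 * (N - 1 - j) * δ ≤ x by linarith)
        have h4 := neg_abs_le
          (P.real {ω | W ω ≤ x - 2 * (N - 1 - j) * δ} - stdNormalCDF (x - 2 * (N - 1 - j) * δ))
        have h5 : 0 ≤ (j : ℝ) * δ := by positivity
        linarith
      rw [Finset.sum_add_distrib] at h1
      simp only [Finset.sum_const, Finset.card_range, nsmul_eq_mul] at h1
      have := havg (x - (2 * N - 1) * δ)
      linarith
  have hDfin : D ≤ 8 * m * δ + T + D / 2 + σ / 4 := by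
    refine (kolmogorovDist_map_stdNormal_eq hW).trans_le (ciSup_le hpt)
  linarith

/-- The `L¹` deviation from the mean is at most the standard deviation. -/
lemma integral_abs_sub_le_sqrt_variance {Y : Ω → ℝ} (hY : IsBddMeasurable Y) :
    ∫ ω, |Y ω - ∫ ω', Y ω' ∂P| ∂P ≤ √(variance Y P) := by
  set m := ∫ ω', Y ω' ∂P with hm
  have hZ := (hY.sub (.const m)).abs
  apply Real.le_sqrt_of_sq_le
  have h := variance_nonneg (fun ω => |Y ω - m|) P
  rw [variance_eq_sub (hZ.memLp P 2)] at h
  rw [variance_eq_integral hY.measurable.aemeasurable]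
  simp only [Pi.pow_apply, sq_abs] at h
  linarith

end Stein

/-! ### Variance of locally dependent sums -/

section LocalDependence

lemma card_filter_near_le (s : Finset ℕ) (i L : ℕ) :
    ({j ∈ s | j < i + L ∧ i < j + L}.card : ℝ) ≤ 2 * L := by
  have h : {j ∈ s | j < i + L ∧ i < j + L} ⊆ Finset.Ico (i + 1 - L) (i + L) := by
    intro j
    simp only [Finset.mem_filter, Finset.mem_Ico]
    omega
  have h1 := Finset.card_le_card h
  rw [Nat.card_Ico] at h1
  have h2 : {j ∈ s | j < i + L ∧ i < j + L}.card ≤ 2 * L := by omega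
  exact_mod_cast h2

/-- A double sum over pairs of indices at distance less than `L`, with terms dominated by the
arithmetic mean of `a i` and `a j`. -/
lemma sum_sum_near_le {s : Finset ℕ} {L : ℕ} {c : ℕ → ℕ → ℝ} {a : ℕ → ℝ}
    (ha : ∀ i ∈ s, 0 ≤ a i) (hc : ∀ i ∈ s, ∀ j ∈ s, c i j ≤ (a i + a j) / 2) :
    ∑ i ∈ s, ∑ j ∈ s with j < i + L ∧ i < j + L, c i j ≤ 2 * L * ∑ i ∈ s, a i := by
  have h1 : ∑ i ∈ s, ∑ j ∈ s with j < i + L ∧ i < j + L, a i ≤ 2 * L * ∑ i ∈ s, a i := by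
    rw [Finset.mul_sum]
    refine Finset.sum_le_sum fun i hi => ?_
    rw [Finset.sum_const, nsmul_eq_mul]
    exact mul_le_mul_of_nonneg_right (card_filter_near_le s i L) (ha i hi)
  have h2 : ∑ i ∈ s, ∑ j ∈ s with j < i + L ∧ i < j + L, a j =
      ∑ i ∈ s, ∑ j ∈ s with j < i + L ∧ i < j + L, a i := by
    simp_rw [Finset.sum_filter]
    rw [Finset.sum_comm]
    simp_rw [and_comm]
  calc ∑ i ∈ s, ∑ j ∈ s with j < i + L ∧ i < j + L, c i j
      ≤ ∑ i ∈ s, ∑ j ∈ s with j < i + L ∧ i < j + L, (a i + a j) / 2 :=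
        Finset.sum_le_sum fun i hi => Finset.sum_le_sum fun j hj =>
          hc i hi j (Finset.mem_filter.1 hj).1
    _ = (∑ i ∈ s, ∑ j ∈ s with j < i + L ∧ i < j + L, a i +
          ∑ i ∈ s, ∑ j ∈ s with j < i + L ∧ i < j + L, a j) / 2 := by
        simp_rw [add_div, Finset.sum_add_distrib, Finset.sum_div]
    _ ≤ 2 * L * ∑ i ∈ s, a i := by
        rw [h2]
        linarith

variable {Ω : Type*} [MeasurableSpace Ω] {P : Measure Ω} [IsProbabilityMeasure P]

/-- Variance of a sum whose terms are independent at index distance at least `L`. -/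
theorem variance_sum_le_of_indepFun_far {s : Finset ℕ} {L : ℕ} {U : ℕ → Ω → ℝ}
    (hU : ∀ i ∈ s, IsBddMeasurable (U i))
    (hind : ∀ i ∈ s, ∀ j ∈ s, i + L ≤ j → IndepFun (U i) (U j) P) :
    variance (fun ω => ∑ i ∈ s, U i ω) P ≤ 2 * L * ∑ i ∈ s, ∫ ω, U i ω ^ 2 ∂P := by
  rw [variance_fun_sum' fun i hi => (hU i hi).memLp P 2]
  have hcov0 : ∀ i ∈ s, ∀ j ∈ s, ¬(j < i + L ∧ i < j + L) → covariance (U i) (U j) P = 0 := by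
    intro i hi j hj h
    rw [not_and_or, not_lt, not_lt] at h
    rcases h with h | h
    · exact (hind i hi j hj h).covariance_eq_zero ((hU i hi).memLp P 2) ((hU j hj).memLp P 2)
    · rw [covariance_comm]
      exact (hind j hj i hi h).covariance_eq_zero ((hU j hj).memLp P 2) ((hU i hi).memLp P 2)
  have h1 : ∑ i ∈ s, ∑ j ∈ s, covariance (U i) (U j) P =
      ∑ i ∈ s, ∑ j ∈ s with j < i + L ∧ i < j + L, covariance (U i) (U j) P := by
    refine Finset.sum_congr rfl fun i hi => ?_
    rw [Finset.sum_filter]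
    refine Finset.sum_congr rfl fun j hj => ?_
    split_ifs with h
    · rfl
    · exact hcov0 i hi j hj h
  rw [h1]
  refine sum_sum_near_le (fun i _ => integral_nonneg fun ω => sq_nonneg _) fun i hi j hj => ?_
  have h2 := variance_nonneg (fun ω => U i ω - U j ω) P
  rw [variance_fun_sub ((hU i hi).memLp P 2) ((hU j hj).memLp P 2)] at h2
  have h3 := variance_le_expectation_sq (μ := P) (hU i hi).measurable.aestronglyMeasurable
  have h4 := variance_le_expectation_sq (μ := P) (hU j hj).measurable.aestronglyMeasurable
  simp only [Pi.pow_apply] at h3 h4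
  linarith

end LocalDependence

/-! ### Normal approximation under local dependence -/

section Combination

variable {Ω : Type*} [MeasurableSpace Ω] {P : Measure Ω} [IsProbabilityMeasure P]

/-- Normal approximation under local dependence, in terms of the size `δ` of the neighbourhood sums
`η i` and of the standard deviations of `∑ ξ i * η i` and `∑ |ξ i * η i|`. -/
theorem kolmogorovDist_le_of_local_dependence {ι : Type*} {s : Finset ι} {ξ η : ι → Ω → ℝ}
    {W : Ω → ℝ} {δ τ m : ℝ} (hW : ∀ ω, W ω = ∑ i ∈ s, ξ i ω)
    (hξ : ∀ i ∈ s, IsBddMeasurable (ξ i)) (hη : ∀ i ∈ s, IsBddMeasurable (η i)) (hδ0 : 0 ≤ δ)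
    (hδ : ∀ i ∈ s, ∀ ω, |η i ω| ≤ δ) (h0 : ∀ i ∈ s, ∫ ω, ξ i ω ∂P = 0)
    (hind : ∀ i ∈ s, IndepFun (ξ i) (fun ω => W ω - η i ω) P)
    (hW2 : ∫ ω, W ω ^ 2 ∂P = 1) (hm : ∫ ω, ∑ i ∈ s, |ξ i ω * η i ω| ∂P = m) (hτ0 : 0 ≤ τ)
    (hQ : variance (fun ω => ∑ i ∈ s, ξ i ω * η i ω) P ≤ τ ^ 2)
    (hY : variance (fun ω => ∑ i ∈ s, |ξ i ω * η i ω|) P ≤ τ ^ 2) :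
    kolmogorovDist (P.map W) (gaussianReal 0 1) ≤ 21 * m * δ + 7 / 2 * τ := by
  have hWb : IsBddMeasurable W := by
    rw [show W = fun ω => ∑ i ∈ s, ξ i ω from funext hW]
    exact .sum hξ
  have hQb : IsBddMeasurable fun ω => ∑ i ∈ s, ξ i ω * η i ω :=
    .sum fun i hi => (hξ i hi).mul (hη i hi)
  have hYb : IsBddMeasurable fun ω => ∑ i ∈ s, |ξ i ω * η i ω| :=
    .sum fun i hi => ((hξ i hi).mul (hη i hi)).abs
  have hQ1 : ∫ ω, ∑ i ∈ s, ξ i ω * η i ω ∂P = 1 := by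
    have h1 : ∀ i ∈ s, ∫ ω, ξ i ω * (W ω - η i ω) ∂P = 0 := by
      intro i hi
      rw [(hind i hi).integral_fun_mul_eq_mul_integral (hξ i hi).measurable.aestronglyMeasurable
        (hWb.sub (hη i hi)).measurable.aestronglyMeasurable, h0 i hi, zero_mul]
    have h2 : ∫ ω, (W ω ^ 2 - ∑ i ∈ s, ξ i ω * η i ω) ∂P = 0 := by
      have h3 : ∀ ω, W ω ^ 2 - ∑ i ∈ s, ξ i ω * η i ω = ∑ i ∈ s, ξ i ω * (W ω - η i ω) := by
        intro ω
        simp only [mul_sub, Finset.sum_sub_distrib, ← Finset.sum_mul, ← hW, sq]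
      simp_rw [h3]
      rw [integral_finsetSum]
      · exact Finset.sum_eq_zero h1
      · exact fun i hi => ((hξ i hi).mul (hWb.sub (hη i hi))).integrable P
    rw [integral_sub ((hWb.pow 2).integrable P) (hQb.integrable P), hW2] at h2
    linarith
  have hm1 : 1 ≤ m := by
    rw [← hm, ← hQ1]
    exact integral_mono (hQb.integrable P) (hYb.integrable P)
      fun ω => Finset.sum_le_sum fun i _ => le_abs_self _
  have hle1 := kolmogorovDist_map_stdNormal_le_one (P := P) hWb.measurable
  have hmδ : δ ≤ m * δ := le_mul_of_one_le_left hδ0 hm1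
  -- The bound is only of interest for `τ ≤ 1` and `δ ≤ 1`, as distances are at most `1`.
  rcases le_or_gt 1 τ with hτ1 | hτ1
  · linarith
  rcases le_or_gt 1 δ with hδ1 | hδ1
  · linarith
  have hQ2 : ∫ ω, |1 - ∑ i ∈ s, ξ i ω * η i ω| ∂P ≤ τ := by
    have h1 := integral_abs_sub_le_sqrt_variance (P := P) hQb
    rw [hQ1] at h1
    simp_rw [abs_sub_comm (1 : ℝ)]
    exact h1.trans ((Real.sqrt_le_left hτ0).2 hQ)
  have hY2 : ∫ ω, |∑ i ∈ s, |ξ i ω * η i ω| - m| ∂P ≤ τ := by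
    have h1 := integral_abs_sub_le_sqrt_variance (P := P) hYb
    rw [hm] at h1
    exact h1.trans ((Real.sqrt_le_left hτ0).2 hY)
  have hYW : ∫ ω, (∑ i ∈ s, |ξ i ω * η i ω|) * (|W ω| + 63 / 50) ∂P ≤
      113 / 50 * m + τ ^ 2 / 2 := by
    have hYsq : ∫ ω, (∑ i ∈ s, |ξ i ω * η i ω|) ^ 2 ∂P ≤ τ ^ 2 + m ^ 2 := by
      rw [variance_eq_sub (hYb.memLp P 2), hm] at hY
      simp only [Pi.pow_apply] at hY
      linarith
    have hpt : ∀ ω, (∑ i ∈ s, |ξ i ω * η i ω|) * (|W ω| + 63 / 50) ≤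
        (∑ i ∈ s, |ξ i ω * η i ω|) ^ 2 / (2 * m) + m / 2 * W ω ^ 2 +
          63 / 50 * ∑ i ∈ s, |ξ i ω * η i ω| := by
      intro ω
      have h1 : 0 ≤ ((∑ i ∈ s, |ξ i ω * η i ω|) - m * |W ω|) ^ 2 / (2 * m) := by positivity
      have h2 : ((∑ i ∈ s, |ξ i ω * η i ω|) - m * |W ω|) ^ 2 / (2 * m) =
          (∑ i ∈ s, |ξ i ω * η i ω|) ^ 2 / (2 * m) + m / 2 * W ω ^ 2 -
            (∑ i ∈ s, |ξ i ω * η i ω|) * |W ω| := by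
        rw [← sq_abs (W ω)]
        have : m ≠ 0 := by positivity
        field_simp
        ring
      linarith
    have hI1 := (hYb.pow 2).div_const (2 * m)
    have hI2 := (IsBddMeasurable.const (m / 2)).mul (hWb.pow 2)
    have hI3 := (IsBddMeasurable.const (63 / 50)).mul hYb
    have h1 := integral_mono ((hYb.mul (hWb.abs.add (.const (63 / 50)))).integrable P)
      (((hI1.add hI2).add hI3).integrable P) hpt
    rw [integral_add ((hI1.add hI2).integrable P) (hI3.integrable P),
      integral_add (hI1.integrable P) (hI2.integrable P), integral_const_mul, integral_const_mul,
      integral_div, hW2, hm] at h1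
    have h2 : (∫ ω, (∑ i ∈ s, |ξ i ω * η i ω|) ^ 2 ∂P) / (2 * m) ≤ τ ^ 2 / 2 + m / 2 := by
      rw [div_le_iff₀ (by positivity)]
      nlinarith [sq_nonneg τ]
    linarith
  have hloc := kolmogorovDist_le_of_local_bound (P := P) (T := τ + δ * (113 / 50 * m + τ ^ 2 / 2))
    hWb.measurable hYb hm1 hY2 hδ0 fun z => by
      refine (abs_measureReal_le_sub_stdNormalCDF_le hW hξ hη hδ h0 hind z).trans ?_
      have := mul_le_mul_of_nonneg_left hYW hδ0
      linarith
  have h3 : δ * τ ^ 2 ≤ τ := by nlinarith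
  have h4 : 0 ≤ m * δ := by positivity
  nlinarith

/-- Normal approximation for a sum of `[0, 1]`-valued variables `X i`, each depending only on the
coordinates in the window `{i, …, i + k - 1}`. The dependence on coordinates is expressed by the
σ-algebras `𝓕 S` generated by the coordinates in `S`, independent for disjoint sets. -/
theorem kolmogorovDist_le_of_window_dependence {𝓕 : Set ℕ → MeasurableSpace Ω}
    (hmono : Monotone 𝓕) (hle : ∀ S, 𝓕 S ≤ ‹MeasurableSpace Ω›)
    (hindep : ∀ S T, Disjoint S T → Indep (𝓕 S) (𝓕 T) P)
    {k : ℕ} {s : Finset ℕ} {X : ℕ → Ω → ℝ}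
    (hX : ∀ i ∈ s, Measurable[𝓕 (Set.Ico i (i + k))] (X i))
    (hX01 : ∀ i ∈ s, ∀ ω, X i ω ∈ Set.Icc (0 : ℝ) 1) {B μ : ℝ} (hB : 0 < B)
    (hB2 : variance (fun ω => ∑ i ∈ s, X i ω) P = B ^ 2) (hμ : ∫ ω, ∑ i ∈ s, X i ω ∂P = μ) :
    kolmogorovDist (P.map fun ω => (∑ i ∈ s, X i ω - μ) / B) (gaussianReal 0 1) ≤
      84 * k ^ 2 * μ / B ^ 3 + 7 / 2 * (√(24 * k ^ 3 * μ) / B ^ 2) := by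
  have hXb : ∀ i ∈ s, IsBddMeasurable (X i) := fun i hi =>
    ⟨(hX i hi).mono (hle _) le_rfl, 1, fun ω => by
      rw [abs_of_nonneg (hX01 i hi ω).1]
      exact (hX01 i hi ω).2⟩
  set π : ℕ → ℝ := fun i => ∫ ω, X i ω ∂P with hπ
  have hμπ : μ = ∑ i ∈ s, π i := by
    rw [← hμ, integral_finsetSum _ fun i hi => (hXb i hi).integrable P]
  have hπ0 : ∀ i ∈ s, 0 ≤ π i := fun i hi => integral_nonneg fun ω => (hX01 i hi ω).1
  have hπ1 : ∀ i ∈ s, π i ≤ 1 := fun i hi => by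
    have := integral_mono ((hXb i hi).integrable P) (integrable_const (1 : ℝ))
      fun ω => (hX01 i hi ω).2
    simpa using this
  have hμ0 : 0 ≤ μ := hμπ ▸ Finset.sum_nonneg hπ0
  set ξ : ℕ → Ω → ℝ := fun i ω => (X i ω - π i) / B with hξdef
  set η : ℕ → Ω → ℝ := fun i ω => ∑ j ∈ s with j < i + k ∧ i < j + k, ξ j ω with hηdef
  set W : Ω → ℝ := fun ω => (∑ i ∈ s, X i ω - μ) / B with hWdef
  have hξm : ∀ i ∈ s, Measurable[𝓕 (Set.Ico i (i + k))] (ξ i) := fun i hi =>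
    ((hX i hi).sub_const (π i)).div_const B
  have hξb : ∀ i ∈ s, IsBddMeasurable (ξ i) := fun i hi =>
    ((hXb i hi).sub (.const (π i))).div_const B
  have hηb : ∀ i ∈ s, IsBddMeasurable (η i) := fun i _ =>
    .sum fun j hj => hξb j (Finset.mem_filter.1 hj).1
  have hW : ∀ ω, W ω = ∑ i ∈ s, ξ i ω := by
    intro ω
    simp only [hWdef, hξdef, ← Finset.sum_div, Finset.sum_sub_distrib, hμπ]
  have hξabs : ∀ i ∈ s, ∀ ω, |ξ i ω| ≤ 1 / B := by
    intro i hi ω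
    simp only [hξdef]
    rw [abs_div, abs_of_pos hB]
    gcongr
    rw [abs_le]
    have h1 := hX01 i hi ω
    have h2 := hπ0 i hi
    have h3 := hπ1 i hi
    constructor <;> linarith [h1.1, h1.2]
  have hδ : ∀ i ∈ s, ∀ ω, |η i ω| ≤ 2 * k / B := by
    intro i hi ω
    refine (Finset.abs_sum_le_sum_abs _ _).trans ?_
    refine (Finset.sum_le_sum fun j hj => hξabs j (Finset.mem_filter.1 hj).1 ω).trans ?_
    rw [Finset.sum_const, nsmul_eq_mul, mul_one_div]
    have := card_filter_near_le s i k
    gcongr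
  have h0 : ∀ i ∈ s, ∫ ω, ξ i ω ∂P = 0 := by
    intro i hi
    simp only [hξdef]
    rw [integral_div, integral_sub ((hXb i hi).integrable P) (integrable_const _)]
    simp [hπ]
  have hξ2 : ∀ i ∈ s, ∫ ω, ξ i ω ^ 2 ∂P ≤ π i / B ^ 2 := by
    intro i hi
    simp only [hξdef, div_pow]
    rw [integral_div]
    gcongr
    have h1 := variance_eq_integral (μ := P) (hXb i hi).measurable.aemeasurable
    rw [variance_eq_sub ((hXb i hi).memLp P 2)] at h1
    have h2 : ∫ ω, (X i ^ 2) ω ∂P ≤ π i :=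
      integral_mono (((hXb i hi).pow 2).integrable P) ((hXb i hi).integrable P) fun ω => by
        have := hX01 i hi ω
        simp only [Pi.pow_apply]
        nlinarith [this.1, this.2]
    have h3 := sq_nonneg (∫ ω, X i ω ∂P)
    simp only [hπ] at h2 ⊢
    linarith
  have hξ2sum : ∑ i ∈ s, ∫ ω, ξ i ω ^ 2 ∂P ≤ μ / B ^ 2 := by
    rw [hμπ, Finset.sum_div]
    exact Finset.sum_le_sum hξ2
  have hindW : ∀ i ∈ s, IndepFun (ξ i) (fun ω => W ω - η i ω) P := by
    intro i hi
    rw [IndepFun_iff_Indep]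
    refine indep_of_indep_of_le_left (indep_of_indep_of_le_right
      (hindep (Set.Ico i (i + k)) (Set.Ico i (i + k))ᶜ disjoint_compl_right) ?_)
      (hξm i hi).comap_le
    apply Measurable.comap_le
    have h1 : (fun ω => W ω - η i ω) =
        fun ω => ∑ j ∈ s with ¬(j < i + k ∧ i < j + k), ξ j ω := by
      ext ω
      rw [hW, ← Finset.sum_filter_add_sum_filter_not s (fun j => j < i + k ∧ i < j + k)]
      simp only [hηdef]
      ring
    rw [h1]
    refine Finset.measurable_fun_sum _ fun j hj => ?_
    rw [Finset.mem_filter] at hj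
    refine (hξm j hj.1).mono (hmono ?_) le_rfl
    intro x hx hx'
    simp only [Set.mem_Ico] at hx hx'
    omega
  have hξηm : ∀ i ∈ s, Measurable[𝓕 {x | i < x + k ∧ x < i + 2 * k}]
      (fun ω => ξ i ω * η i ω) := by
    intro i hi
    refine Measurable.mul ?_ ?_
    · refine (hξm i hi).mono (hmono ?_) le_rfl
      intro x hx
      simp only [Set.mem_Ico, Set.mem_ofPred_eq] at hx ⊢
      omega
    · refine Finset.measurable_fun_sum _ fun j hj => ?_
      rw [Finset.mem_filter] at hj
      refine (hξm j hj.1).mono (hmono ?_) le_rfl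
      intro x hx
      simp only [Set.mem_Ico, Set.mem_ofPred_eq] at hx ⊢
      omega
  have hfar : ∀ i ∈ s, ∀ j ∈ s, i + 3 * k ≤ j →
      IndepFun (fun ω => ξ i ω * η i ω) (fun ω => ξ j ω * η j ω) P := by
    intro i hi j hj hij
    rw [IndepFun_iff_Indep]
    refine indep_of_indep_of_le_left (indep_of_indep_of_le_right
      (hindep _ _ ?_) (hξηm j hj).comap_le) (hξηm i hi).comap_le
    rw [Set.disjoint_left]
    intro x hx hx'
    simp only [Set.mem_ofPred_eq] at hx hx'
    omega
  have hW2 : ∫ ω, W ω ^ 2 ∂P = 1 := by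
    simp only [hWdef, div_pow]
    rw [integral_div, ← hμ, ← variance_eq_integral, hB2, div_self (by positivity)]
    exact (IsBddMeasurable.sum hXb).measurable.aemeasurable
  have hm : ∫ ω, ∑ i ∈ s, |ξ i ω * η i ω| ∂P ≤ 2 * k * (μ / B ^ 2) := by
    have hpt : ∀ ω, ∑ i ∈ s, |ξ i ω * η i ω| ≤ 2 * k * ∑ i ∈ s, ξ i ω ^ 2 := by
      intro ω
      refine le_trans (Finset.sum_le_sum fun i hi => ?_)
        (sum_sum_near_le (c := fun i j => |ξ i ω| * |ξ j ω|) (fun i _ => sq_nonneg (ξ i ω))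
          fun i _ j _ => ?_)
      · rw [abs_mul, ← Finset.mul_sum]
        exact mul_le_mul_of_nonneg_left (Finset.abs_sum_le_sum_abs _ _) (abs_nonneg _)
      · have := sq_nonneg (|ξ i ω| - |ξ j ω|)
        rw [← sq_abs (ξ i ω), ← sq_abs (ξ j ω)]
        linarith
    have hsq : IsBddMeasurable fun ω => ∑ i ∈ s, ξ i ω ^ 2 := .sum fun i hi => (hξb i hi).pow 2
    refine (integral_mono
      ((IsBddMeasurable.sum fun i hi => ((hξb i hi).mul (hηb i hi)).abs).integrable P)
      (((IsBddMeasurable.const _).mul hsq).integrable P) hpt).trans ?_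
    rw [integral_const_mul, integral_finsetSum _ fun i hi => ((hξb i hi).pow 2).integrable P]
    gcongr
  have hsum : 2 * ((3 * k : ℕ) : ℝ) * ∑ i ∈ s, ∫ ω, (ξ i ω * η i ω) ^ 2 ∂P ≤
      (√(24 * k ^ 3 * μ) / B ^ 2) ^ 2 := by
    have h1 : ∑ i ∈ s, ∫ ω, (ξ i ω * η i ω) ^ 2 ∂P ≤ (2 * k / B) ^ 2 * (μ / B ^ 2) := by
      refine le_trans ?_ (mul_le_mul_of_nonneg_left hξ2sum (by positivity))
      rw [Finset.mul_sum]
      refine Finset.sum_le_sum fun i hi => ?_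
      rw [← integral_const_mul]
      refine integral_mono ((((hξb i hi).mul (hηb i hi)).pow 2).integrable P)
        (((IsBddMeasurable.const _).mul ((hξb i hi).pow 2)).integrable P) fun ω => ?_
      rw [mul_pow, mul_comm]
      refine mul_le_mul_of_nonneg_right ?_ (sq_nonneg _)
      rw [← sq_abs (η i ω)]
      exact pow_le_pow_left₀ (abs_nonneg _) (hδ i hi ω) 2
    refine (mul_le_mul_of_nonneg_left h1 (by positivity)).trans (le_of_eq ?_)
    rw [div_pow √_, Real.sq_sqrt (by positivity)]
    push_cast
    field_simp
    ring
  have hmain := kolmogorovDist_le_of_local_dependence (P := P) hW hξb hηb (by positivity) hδ h0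
    hindW hW2 rfl (τ := √(24 * k ^ 3 * μ) / B ^ 2) (by positivity)
    ((variance_sum_le_of_indepFun_far (fun i hi => (hξb i hi).mul (hηb i hi)) hfar).trans hsum)
    ((variance_sum_le_of_indepFun_far (L := 3 * k) (fun i hi => ((hξb i hi).mul (hηb i hi)).abs)
      fun i hi j hj hij => (hfar i hi j hj hij).comp measurable_abs measurable_abs).trans
      (by simpa only [sq_abs] using hsum))
  refine hmain.trans ?_
  gcongr
  calc 21 * (∫ ω, ∑ i ∈ s, |ξ i ω * η i ω| ∂P) * (2 * k / B)
      ≤ 21 * (2 * k * (μ / B ^ 2)) * (2 * k / B) := by gcongr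
    _ = 84 * k ^ 2 * μ / B ^ 3 := by
      field_simp
      ring

end Combination

/-! ### Runs -/

section Runs

variable {Ω : Type*} {n : ℕ} {I : ℕ → Ω → ℝ} {p : ℕ → ℝ}

/-- The σ-algebra generated by those of `I 1, …, I n` whose index lies in `S`. -/
abbrev coordAlgebra (n : ℕ) (I : ℕ → Ω → ℝ) (S : Set ℕ) : MeasurableSpace Ω :=
  ⨆ i ∈ {i : Finset.Icc 1 n | (i : ℕ) ∈ S}, MeasurableSpace.comap (I i) inferInstance

lemma monotone_coordAlgebra : Monotone (coordAlgebra n I) := fun _ _ hST =>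
  biSup_mono fun _ hi => hST hi

lemma measurable_coordAlgebra {S : Set ℕ} {j : ℕ} (hj : j ∈ Finset.Icc 1 n) (hS : j ∈ S) :
    Measurable[coordAlgebra n I S] (I j) :=
  (comap_measurable (I j)).mono
    (le_iSup₂_of_le (f := fun (i : Finset.Icc 1 n) (_ : (i : ℕ) ∈ S) =>
      MeasurableSpace.comap (I i) inferInstance) ⟨j, hj⟩ hS le_rfl) le_rfl

variable [MeasurableSpace Ω] {P : Measure Ω}

namespace IsIndepIndicators

lemma coordAlgebra_le (h : IsIndepIndicators P n I p) (S : Set ℕ) :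
    coordAlgebra n I S ≤ ‹MeasurableSpace Ω› :=
  iSup₂_le fun i _ => (h.measurable i i.2).comap_le

lemma indep_coordAlgebra (h : IsIndepIndicators P n I p) (S T : Set ℕ) (hST : Disjoint S T) :
    Indep (coordAlgebra n I S) (coordAlgebra n I T) P :=
  indep_iSup_of_disjoint (fun i : Finset.Icc 1 n => (h.measurable i i.2).comap_le) h.indep.iIndep
    (hST.preimage (Subtype.val : Finset.Icc 1 n → ℕ))

lemma prod_zero_or_one (h : IsIndepIndicators P n I p) {T : Finset ℕ} (hT : T ⊆ Finset.Icc 1 n)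
    (ω : Ω) : (∃ j ∈ T, I j ω = 0) ∧ ∏ j ∈ T, I j ω = 0 ∨
      (∀ j ∈ T, I j ω = 1) ∧ ∏ j ∈ T, I j ω = 1 := by
  by_cases h0 : ∃ j ∈ T, I j ω = 0
  · obtain ⟨j, hj, hj0⟩ := h0
    exact Or.inl ⟨⟨j, hj, hj0⟩, Finset.prod_eq_zero hj hj0⟩
  · push Not at h0
    have h1 : ∀ j ∈ T, I j ω = 1 := fun j hj => (h.zero_or_one j (hT hj) ω).resolve_left (h0 j hj)
    exact Or.inr ⟨h1, Finset.prod_eq_one h1⟩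

lemma prod_mem_Icc (h : IsIndepIndicators P n I p) {T : Finset ℕ} (hT : T ⊆ Finset.Icc 1 n)
    (ω : Ω) : ∏ j ∈ T, I j ω ∈ Set.Icc (0 : ℝ) 1 := by
  rcases h.prod_zero_or_one hT ω with ⟨_, h1⟩ | ⟨_, h1⟩ <;> rw [h1] <;> simp

/-- Indicators are idempotent. -/
lemma prod_mul_prod (h : IsIndepIndicators P n I p) {S T : Finset ℕ} (hS : S ⊆ Finset.Icc 1 n)
    (ω : Ω) :
    (∏ j ∈ S, I j ω) * ∏ j ∈ T, I j ω = ∏ j ∈ S ∪ T, I j ω := by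
  rw [← Finset.prod_union_inter]
  rcases h.prod_zero_or_one (Finset.inter_subset_left.trans hS : S ∩ T ⊆ _) ω with
    ⟨⟨j, hj, hj0⟩, h1⟩ | ⟨_, h1⟩
  · rw [h1, Finset.prod_eq_zero (Finset.mem_union_left T (Finset.mem_inter.1 hj).1) hj0, mul_zero]
  · rw [h1, mul_one]

lemma isBddMeasurable_prod (h : IsIndepIndicators P n I p) {T : Finset ℕ}
    (hT : T ⊆ Finset.Icc 1 n) : IsBddMeasurable fun ω => ∏ j ∈ T, I j ω :=
  ⟨Finset.measurable_fun_prod T fun j hj => h.measurable j (hT hj), 1, fun ω => by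
    have := h.prod_mem_Icc hT ω
    rw [abs_of_nonneg this.1]
    exact this.2⟩

lemma integral_eq (h : IsIndepIndicators P n I p) {j : ℕ} (hj : j ∈ Finset.Icc 1 n) :
    ∫ ω, I j ω ∂P = p j := by
  have h1 : MeasurableSet {ω | I j ω = 1} := h.measurable j hj (measurableSet_singleton 1)
  rw [← h.prob_one j hj, ← integral_indicator_one h1]
  refine integral_congr_ae (Filter.Eventually.of_forall fun ω => ?_)
  rcases h.zero_or_one j hj ω with h0 | h0 <;> simp [Set.indicator, h0]

lemma integral_prod_eq (h : IsIndepIndicators P n I p) {T : Finset ℕ}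
    (hT : T ⊆ Finset.Icc 1 n) : ∫ ω, ∏ j ∈ T, I j ω ∂P = ∏ j ∈ T, p j := by
  have h1 : iIndepFun (fun j : T => I j) P :=
    h.indep.precomp (g := fun j : T => (⟨j, hT j.2⟩ : Finset.Icc 1 n))
      fun a b hab => Subtype.ext (by simpa using hab)
  have h2 := h1.integral_fun_prod_eq_prod_integral
    fun j => (h.measurable j (hT j.2)).aestronglyMeasurable
  rw [← Finset.prod_coe_sort T p]
  simp_rw [← Finset.prod_coe_sort T (fun j => I j _)]
  rw [h2]
  exact Finset.prod_congr rfl fun j _ => h.integral_eq (hT j.2)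

end IsIndepIndicators

lemma window_subset {k i : ℕ} (hi : i ∈ Finset.Icc 1 (n + 1 - k)) :
    Finset.Ico i (i + k) ⊆ Finset.Icc 1 n := by
  intro j
  simp only [Finset.mem_Icc, Finset.mem_Ico] at *
  omega

lemma runSD_sq (k : ℕ) : runSD P k n I ^ 2 = variance (runCount k n I) P :=
  Real.sq_sqrt (variance_nonneg _ _)

lemma runMean_nonneg (h : IsIndepIndicators P n I p) (k : ℕ) : 0 ≤ runMean P k n I :=
  integral_nonneg fun ω => Finset.sum_nonneg fun _ hi => (h.prod_mem_Icc (window_subset hi) ω).1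

variable [IsProbabilityMeasure P]

lemma runMean_eq_windowSum (h : IsIndepIndicators P n I p) (k : ℕ) :
    runMean P k n I = windowSum k n p := by
  unfold runMean runCount windowSum
  rw [integral_finsetSum _ fun i hi => (h.isBddMeasurable_prod (window_subset hi)).integrable P]
  exact Finset.sum_congr rfl fun i hi => h.integral_prod_eq (window_subset hi)

theorem kolmogorovDist_runStandardized_le (h : IsIndepIndicators P n I p) (k : ℕ)
    (hB : 0 < runSD P k n I) :
    kolmogorovDist (P.map (runStandardized P k n I)) (gaussianReal 0 1) ≤
      (14 * √2 + 8) * (k : ℝ) ^ (3 / 2 : ℝ) * (runMean P k n I) ^ (1 / 2 : ℝ)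
          / (runSD P k n I) ^ 2
        + 102 * (k : ℝ) ^ 2 * runMean P k n I / (runSD P k n I) ^ 3 := by
  have hμ0 := runMean_nonneg h k
  have h1 := kolmogorovDist_le_of_window_dependence (P := P) (k := k)
    (s := Finset.Icc 1 (n + 1 - k)) (X := fun i ω => ∏ j ∈ Finset.Ico i (i + k), I j ω)
    monotone_coordAlgebra h.coordAlgebra_le h.indep_coordAlgebra
    (fun i hi => Finset.measurable_fun_prod _ fun j hj =>
      measurable_coordAlgebra (window_subset hi hj) (Finset.mem_Ico.1 hj))
    (fun i hi ω => h.prod_mem_Icc (window_subset hi) ω) hB (runSD_sq k).symm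
    (μ := runMean P k n I) rfl
  have h2 : √(24 * k ^ 3 * runMean P k n I) =
      √24 * ((k : ℝ) ^ (3 / 2 : ℝ) * (runMean P k n I) ^ (1 / 2 : ℝ)) := by
    rw [Real.sqrt_mul (by positivity), Real.sqrt_mul (by positivity),
      Real.sqrt_eq_rpow (runMean P k n I), Real.sqrt_eq_rpow ((k : ℝ) ^ 3), ← Real.rpow_natCast,
      ← Real.rpow_mul (by positivity), mul_assoc]
    norm_num
  have h3 : 7 / 2 * √24 ≤ 14 * √2 + 8 := by
    have h4 : √24 ≤ 5 := by
      rw [Real.sqrt_le_left (by norm_num)]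
      norm_num
    have h5 : 1 ≤ √2 := Real.one_le_sqrt.2 (by norm_num)
    linarith
  refine h1.trans ?_
  rw [h2, add_comm]
  refine add_le_add ?_ ?_
  · rw [← mul_div_assoc, ← mul_assoc, mul_assoc (14 * √2 + 8)]
    gcongr
  · gcongr
    norm_num

/-- For identically distributed indicators the number of windows times the variance of a single
window product bounds the variance of `S_n` below, since window products are nonnegatively
correlated. -/
lemma le_runSD_sq {k : ℕ} {q : ℝ} (hq0 : 0 ≤ q) (hq1 : q ≤ 1)
    (h : IsIndepIndicators P n I fun _ => q) :
    ((n + 1 - k : ℕ) : ℝ) * (q ^ k * (1 - q ^ k)) ≤ runSD P k n I ^ 2 := by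
  have hb := fun (i : ℕ) (hi : i ∈ Finset.Icc 1 (n + 1 - k)) =>
    h.isBddMeasurable_prod (window_subset hi)
  have hcov : ∀ i ∈ Finset.Icc 1 (n + 1 - k), ∀ j ∈ Finset.Icc 1 (n + 1 - k),
      covariance (fun ω => ∏ l ∈ Finset.Ico i (i + k), I l ω)
        (fun ω => ∏ l ∈ Finset.Ico j (j + k), I l ω) P =
      q ^ (Finset.Ico i (i + k) ∪ Finset.Ico j (j + k)).card - q ^ k * q ^ k := by
    intro i hi j hj
    rw [covariance_eq_sub ((hb i hi).memLp P 2) ((hb j hj).memLp P 2)]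
    simp only [Pi.mul_apply, h.prod_mul_prod (window_subset hi)]
    rw [h.integral_prod_eq (window_subset hi), h.integral_prod_eq (window_subset hj),
      h.integral_prod_eq (Finset.union_subset (window_subset hi) (window_subset hj))]
    simp
  rw [runSD_sq]
  unfold runCount windowSum
  rw [variance_fun_sum' fun i hi => (hb i hi).memLp P 2]
  have hdiag : ∀ i ∈ Finset.Icc 1 (n + 1 - k), q ^ k * (1 - q ^ k) ≤
      ∑ j ∈ Finset.Icc 1 (n + 1 - k), covariance (fun ω => ∏ l ∈ Finset.Ico i (i + k), I l ω)
        (fun ω => ∏ l ∈ Finset.Ico j (j + k), I l ω) P := by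
    intro i hi
    refine le_trans (le_of_eq ?_) (Finset.single_le_sum (fun j hj => ?_) hi)
    · rw [hcov i hi i hi, Finset.union_idempotent]
      simp
      ring
    · rw [hcov i hi j hj, ← pow_add, sub_nonneg]
      refine pow_le_pow_of_le_one hq0 hq1 ((Finset.card_union_le _ _).trans ?_)
      simp
  have := Finset.card_nsmul_le_sum _ _ _ hdiag
  simpa using this

end Runs

theorem mainTheorem6 :
    (∀ (k n : ℕ) (p : ℕ → ℝ) (Ω : Type*) [MeasurableSpace Ω] (P : Measure Ω)
        [IsProbabilityMeasure P] (I : ℕ → Ω → ℝ),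
        1 ≤ k → IsIndepIndicators P n I p →
        runMean P k n I = windowSum k n p ∧
        (0 < runSD P k n I →
          kolmogorovDist (P.map (runStandardized P k n I)) (gaussianReal 0 1) ≤
            (14 * √2 + 8) * (k : ℝ) ^ (3 / 2 : ℝ) * (runMean P k n I) ^ (1 / 2 : ℝ)
                / (runSD P k n I) ^ 2
              + 102 * (k : ℝ) ^ 2 * runMean P k n I / (runSD P k n I) ^ 3)) ∧
    (∀ (k : ℕ) (p : ℝ), 1 ≤ k → 0 < p → p < 1 →
        ∃ C : ℝ, ∀ (n : ℕ) (Ω : Type*) [MeasurableSpace Ω] (P : Measure Ω)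
          [IsProbabilityMeasure P] (I : ℕ → Ω → ℝ),
          k ≤ n → IsIndepIndicators P n I (fun _ => p) →
          0 < runSD P k n I ∧
          kolmogorovDist (P.map (runStandardized P k n I)) (gaussianReal 0 1) ≤
            C * (n : ℝ) ^ (-(1 / 2) : ℝ)) := by
  refine ⟨fun k n p Ω _ P _ I _ h =>
    ⟨runMean_eq_windowSum h k, kolmogorovDist_runStandardized_le h k⟩, ?_⟩
  intro k p hk hp0 hp1
  have hpk : p ^ k < 1 := pow_lt_one₀ hp0.le hp1 (by omega)
  have hv : 0 < p ^ k * (1 - p ^ k) := mul_pos (pow_pos hp0 k) (by linarith)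
  set u : ℝ := √(p ^ k * (1 - p ^ k)) with hu
  have hu0 : 0 < u := Real.sqrt_pos.2 hv
  set c : ℝ := (14 * √2 + 8) * (k : ℝ) ^ (3 / 2 : ℝ) with hc
  refine ⟨(c / u ^ 2 + 102 * (k : ℝ) ^ 2 / u ^ 3) * √k, fun n Ω _ P _ I hkn h => ?_⟩
  set M : ℝ := √((n + 1 - k : ℕ) : ℝ) with hM
  have hM0 : 0 < M := Real.sqrt_pos.2 (Nat.cast_pos.2 (by omega))
  have hM2 : M ^ 2 = ((n + 1 - k : ℕ) : ℝ) := Real.sq_sqrt (Nat.cast_nonneg _)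
  have hBM : M * u ≤ runSD P k n I := by
    refine (sq_le_sq₀ (by positivity) (Real.sqrt_nonneg _)).1 ?_
    rw [mul_pow, hM2, hu, Real.sq_sqrt hv.le]
    exact le_runSD_sq hp0.le hp1.le h
  have hB : 0 < runSD P k n I := (mul_pos hM0 hu0).trans_le hBM
  refine ⟨hB, (kolmogorovDist_runStandardized_le h k hB).trans ?_⟩
  have hμ0 := runMean_nonneg h k
  have hμ : runMean P k n I ≤ M ^ 2 := by
    rw [runMean_eq_windowSum h, windowSum, hM2]
    simp only [Finset.prod_const, Nat.card_Ico, add_tsub_cancel_left, Finset.sum_const,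
      Nat.card_Icc, nsmul_eq_mul, add_tsub_cancel_right]
    exact mul_le_of_le_one_right (Nat.cast_nonneg _) hpk.le
  have hμ' : runMean P k n I ^ (1 / 2 : ℝ) ≤ M := by
    rw [← Real.sqrt_eq_rpow]
    exact (Real.sqrt_le_left hM0.le).2 hμ
  -- There are `n + 1 - k ≥ n / k` windows.
  have hnM : √k * (n : ℝ) ^ (-(1 / 2) : ℝ) ≥ 1 / M := by
    have hn0 : 0 < (n : ℝ) := Nat.cast_pos.2 (by omega)
    rw [Real.rpow_neg hn0.le, ← Real.sqrt_eq_rpow, ← div_eq_mul_inv, ge_iff_le,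
      div_le_div_iff₀ hM0 (Real.sqrt_pos.2 hn0), one_mul, hM, ← Real.sqrt_mul (Nat.cast_nonneg _)]
    apply Real.sqrt_le_sqrt
    have : n ≤ k * (n + 1 - k) := by
      obtain ⟨d, rfl⟩ := Nat.exists_eq_add_of_le hkn
      rw [show k + d + 1 - k = d + 1 by omega]
      nlinarith
    exact_mod_cast this
  calc c * runMean P k n I ^ (1 / 2 : ℝ) / runSD P k n I ^ 2 +
        102 * (k : ℝ) ^ 2 * runMean P k n I / runSD P k n I ^ 3
      ≤ c * M / (M * u) ^ 2 + 102 * (k : ℝ) ^ 2 * M ^ 2 / (M * u) ^ 3 := by gcongr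
    _ = (c / u ^ 2 + 102 * (k : ℝ) ^ 2 / u ^ 3) * (1 / M) := by
      field_simp
    _ ≤ (c / u ^ 2 + 102 * (k : ℝ) ^ 2 / u ^ 3) * (√k * (n : ℝ) ^ (-(1 / 2) : ℝ)) := by
      gcongr
    _ = _ := by ring
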